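/- **Definitions.** For a weight function $\rho$ on an interval $(a,b)$, the nodes and weights of the $n$-point Gauss rule are $n$ distinct points $x_1<\dots<x_n$ in $(a,b)$ and numbers $\omega_1,\dots,\omega_n$ with $\sum_k\omega_k p(x_k)=\int_a^b\rho(s)p(s)\,ds$ for every real polynomial $p$ of degree at most $2n-1$ (Gauss–Legendre: $\rho=1$; Gauss–Jacobi on $[0,a]$: $\rho(s)=s^{\alpha-1}$). For $\alpha>0$, integers $m,n$ with $-m\le n$, and positive integers $n_1,n_2$, the *hybrid Gauss sum of exponentials* is $$\sum_{i=1}^{N_A}\tilde w_ie^{-\tilde s_it}=\frac1{\Gamma(\alpha)}\Big[\sum_{k=1}^{n_1}\omega_{0,k}e^{-x_{0,k}t}+\sum_{j=-m}^{n-1}\sum_{k=1}^{n_2}\omega_{j,k}x_{j,k}^{\alpha-1}e^{-x_{j,k}t}\Big],\qquad N_A=n_1+(m+n)n_2,$$ where $x_{0,k},\omega_{0,k}$ (first sum) are the nodes and weights of the $n_1$-point Gauss–Jacobi rule with weight $s^{\alpha-1}$ on $[0,2^{-m}]$, and $x_{j,k},\omega_{j,k}$ (second sum) those of the $n_2$-point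 Gauss–Legendre rule on $[2^j,2^{j+1}]$; the nodes $\tilde s_i$ are all the $x$'s, and the weights $\tilde w_i$ are the numbers $\omega_{0,k}/\Gamma(\alpha)$ and $\omega_{j,k}x_{j,k}^{\alpha-1}/\Gamma(\alpha)$. (It results from $t^{-\alpha}=\frac1{\Gamma(\alpha)}\int_0^\infty e^{-ts}s^{\alpha-1}ds$ by dropping the integral over $(2^n,\infty)$ and applying these rules on the remaining intervals.) **Theorem.** (1) For all $A>0$ and $T_0>0$ there is a constant $C$, depending only on $A$ and $T_0$, such that for all $\alpha\in(0,A]$, all $0<\delta<T$ with $T\ge T_0$, and all $\varepsilon_0>0$, there are positive nodes $\tilde s_i$ and positive weights $\tilde w_i$, $i=1,\dots,N_A$, with $$N_A\le C\Big(1+\max\big(0,\log\tfrac1{\varepsilon_0}\big)+\log\tfrac T\delta\Big)^2,\qquad \Big|\frac1{t^\alpha}-\sum_{i=1}^{N_A}\tilde w_ie^{-\tilde s_it}\Big|\le\varepsilon_0\quad\text{for all }t\in[\delta,T],$$ and they are the nodes and weights of the hybrid Gauss sum of exponentials for some $m,n\in\mathbb Z$ with $-m\le n$ and some $n_1,n_2\ge2$.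 (In particular $N_A=O\big((\log\frac1{\varepsilon_0}+\log\frac T\delta)^2\big)$ for $\varepsilon_0\le\frac12$.) (2) Let $0<\alpha<1$, $0<\delta<T$, $m,n\in\mathbb Z$ with $-m\le n$, and $n_1,n_2\ge2$. The hybrid Gauss sum of exponentials with these parameters exists, its nodes $\tilde s_i$ and weights $\tilde w_i$ are positive, and for all $t\in[\delta,T]$ $$\Big|\frac1{t^\alpha}-\sum_{i=1}^{N_A}\tilde w_ie^{-\tilde s_it}\Big|\le\frac{e^{-\delta2^n}}{\Gamma(\alpha)\,\delta\,2^{(1-\alpha)n}}+\frac1{\Gamma(\alpha)}\left[\frac{4\sqrt\pi\,2^{-\alpha m}}{e^2}\,\frac{(2n_1-1)n_1^{3/2}}{2n_1+\alpha}\left(\frac{2^{-m}e\,n_1T}{2(2n_1-1)^2}\right)^{2n_1}+2\sqrt2\,\pi\Big(\sum_{j=-m}^{n-1}2^{\alpha j}\Big)\left(\frac{e^{1/e}}4\right)^{2n_2}\right].$$ -/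

import Mathlib

/-- `x` and `ω` are the nodes and weights of the `n`-point Gauss quadrature rule for the weight
function `ρ` on the interval `(a, b)`: `n` distinct nodes in `(a, b)`, listed in increasing order,
such that the rule is exact for all real polynomials of degree at most `2 * n - 1`. -/
def IsGaussRule (ρ : ℝ → ℝ) (a b : ℝ) {n : ℕ} (x ω : Fin n → ℝ) : Prop :=
  StrictMono x ∧ (∀ k, x k ∈ Set.Ioo a b) ∧
    ∀ p : Polynomial ℝ, p.degree < ((2 * n : ℕ) : WithBot ℕ) →
      ∑ k, ω k * p.eval (x k) = ∫ s in a..b, ρ s * p.eval s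

/-- `n`-point Gauss–Legendre rule on `[a, b]` (weight function `1`). -/
def IsGaussLegendre (a b : ℝ) {n : ℕ} (x ω : Fin n → ℝ) : Prop :=
  IsGaussRule (fun _ => 1) a b x ω

/-- `n`-point Gauss–Jacobi rule on `[0, a]` with weight function `s ^ (α - 1)`. -/
def IsGaussJacobi (α a : ℝ) {n : ℕ} (x ω : Fin n → ℝ) : Prop :=
  IsGaussRule (fun s => s ^ (α - 1)) 0 a x ω

/-- The exponents `s` and coefficients `w` of the sum of exponentials that results from
`t ^ (-α) = (Γ α)⁻¹ * ∫ s in (0, ∞), exp (-t * s) * s ^ (α - 1)` by dropping the integral over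
`(2 ^ n, ∞)`, applying the `n₁`-point Gauss–Jacobi rule with weight `s ^ (α - 1)` on
`[0, 2 ^ (-m)]`, and the `n₂`-point Gauss–Legendre rule on each dyadic interval
`[2 ^ j, 2 ^ (j + 1)]`, `-m ≤ j ≤ n - 1`. The modes are numbered by `Fin N` in any order. -/
def IsHybridGauss (α : ℝ) (m n : ℤ) (n₁ n₂ : ℕ) {N : ℕ} (s w : Fin N → ℝ) : Prop :=
  ∃ (x₀ ω₀ : Fin n₁ → ℝ) (x ω : ℤ → Fin n₂ → ℝ),
    IsGaussJacobi α ((2 : ℝ) ^ (-m)) x₀ ω₀ ∧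
    (∀ j ∈ Finset.Ico (-m) n, IsGaussLegendre ((2 : ℝ) ^ j) ((2 : ℝ) ^ (j + 1)) (x j) (ω j)) ∧
    ∃ e : (Fin n₁ ⊕ (Finset.Ico (-m) n) × Fin n₂) ≃ Fin N,
      (∀ k : Fin n₁, s (e (Sum.inl k)) = x₀ k ∧
        w (e (Sum.inl k)) = ω₀ k / Real.Gamma α) ∧
      (∀ (j : Finset.Ico (-m) n) (k : Fin n₂), s (e (Sum.inr (j, k))) = x j k ∧
        w (e (Sum.inr (j, k))) = ω j k * (x j k) ^ (α - 1) / Real.Gamma α)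

/-- The explicit error bound: truncation at `2 ^ n`, Gauss–Jacobi on `[0, 2 ^ (-m)]`, and
Gauss–Legendre on the dyadic intervals. -/
noncomputable def hybridGaussBound (α δ T : ℝ) (m n : ℤ) (n₁ n₂ : ℕ) : ℝ :=
  Real.exp (-(δ * (2 : ℝ) ^ n)) / (Real.Gamma α * δ * (2 : ℝ) ^ ((1 - α) * (n : ℝ))) +
    1 / Real.Gamma α *
      (4 * √Real.pi * (2 : ℝ) ^ (-(α * (m : ℝ))) / Real.exp 1 ^ 2 *
          ((2 * (n₁ : ℝ) - 1) * (n₁ : ℝ) ^ (3 / 2 : ℝ) / (2 * (n₁ : ℝ) + α)) *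
          ((2 : ℝ) ^ (-m) * Real.exp 1 * (n₁ : ℝ) * T / (2 * (2 * (n₁ : ℝ) - 1) ^ 2)) ^ (2 * n₁) +
        2 * √2 * Real.pi * (∑ j ∈ Finset.Ico (-m) n, (2 : ℝ) ^ (α * (j : ℝ))) *
          (Real.exp (1 / Real.exp 1) / 4) ^ (2 * n₂))

/-! Both parts rest on one estimate, `IsHybridGauss.error_le`. With `t ^ (-α)` written as a Gamma
integral, the error is the discarded tail plus the errors of the individual Gauss rules.

For an `n`-point Gauss rule, Hermite interpolation at the doubled nodes is integrated exactly. The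
error is therefore at most `sup |F⁽²ⁿ⁾| / (2n)!` times the weighted integral of `π²`, where `π` is
the nodal polynomial (`abs_sub_hermite_le`). Since `π` is orthogonal to all lower degrees, it
minimises this integral among monic polynomials of degree `n` (`IsPositiveOn.nodal_sq_le`), so any
monic competitor gives a bound (`IsGaussRule.error_le`); competitors are built from Chebyshev
polynomials. On `[c, 2c]` the derivatives of `exp (-t s) s ^ (α - 1)` are bounded independently of
`t`, and the error decays like `16 ^ (-n)`. On `[0, a]` the power is the weight, only the
exponential is differentiated, and the error is small once `a t ≤ 1`.

The explicit bound follows by weakening these estimates to the stated constants. For the count of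
nodes, let `X = 1 + max 0 (log (1/ε₀)) + log (T/δ)` and take `a` of size `1/T` and the truncation
point `b` of size `X/δ`. Then `log (b/a) = O(X)`, so `O(X)` dyadic intervals with `O(X)` nodes each
suffice. -/

open Polynomial

/-! ### Gauss quadrature for positive functionals -/

/-- A linear functional on real polynomials which is positive on nonzero polynomials that are
nonnegative on `(a, b)`. -/
structure IsPositiveOn (L : ℝ[X] →ₗ[ℝ] ℝ) (a b : ℝ) : Prop where
  lt : a < b
  pos : ∀ p : ℝ[X], p ≠ 0 → (∀ s ∈ Set.Ioo a b, 0 ≤ p.eval s) → 0 < L p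

namespace IsPositiveOn

variable {L : ℝ[X] →ₗ[ℝ] ℝ} {a b : ℝ}

theorem sq_pos (hL : IsPositiveOn L a b) {p : ℝ[X]} (hp : p ≠ 0) : 0 < L (p * p) :=
  hL.pos _ (mul_ne_zero hp hp) fun s _ => by rw [eval_mul]; exact mul_self_nonneg _

theorem sq_nonneg (hL : IsPositiveOn L a b) (p : ℝ[X]) : 0 ≤ L (p * p) := by
  by_cases hp : p = 0
  · simp [hp]
  · exact (hL.sq_pos hp).le

/-- Existence of monic orthogonal polynomials. -/
theorem exists_orthogonal (hL : IsPositiveOn L a b) (n : ℕ) :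
    ∃ P : ℝ[X], P.Monic ∧ P.natDegree = n ∧ ∀ q : ℝ[X], q.degree < n → L (P * q) = 0 := by
  -- The Gram form of `L` on polynomials of degree `< n` is definite, so `φ` is injective and, by
  -- dimension, onto the dual. The element `r` representing `q ↦ L (X ^ n * q)` is the projection of
  -- `X ^ n`, and `X ^ n - r` is orthogonal.
  let φ : degreeLT ℝ n →ₗ[ℝ] Module.Dual ℝ (degreeLT ℝ n) :=
    LinearMap.mk₂ ℝ (fun p q => L ((p : ℝ[X]) * q))
      (fun p p' q => by simp [add_mul]) (fun c p q => by simp)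
      (fun p q q' => by simp [mul_add]) (fun c p q => by simp)
  have hinj : Function.Injective φ := by
    rw [injective_iff_map_eq_zero]
    intro p hp
    by_contra hne
    have h1 : L ((p : ℝ[X]) * p) = 0 := by
      have := congrArg (fun f => f p) hp
      simpa [φ] using this
    exact (hL.sq_pos (p := (p : ℝ[X])) (fun h => hne (Subtype.ext h))).ne' h1
  have hfin : Module.Finite ℝ (degreeLT ℝ n) :=
    Module.Finite.equiv (degreeLTEquiv ℝ n).symm
  have hsurj : Function.Surjective φ :=
    (LinearMap.injective_iff_surjective_of_finrank_eq_finrank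
      (Subspace.dual_finrank_eq (K := ℝ) (V := degreeLT ℝ n)).symm).1 hinj
  obtain ⟨r, hr⟩ := hsurj ((L ∘ₗ LinearMap.mulLeft ℝ (X ^ n)) ∘ₗ (degreeLT ℝ n).subtype)
  have hrd : (r : ℝ[X]).degree < n := mem_degreeLT.1 r.2
  refine ⟨X ^ n - (r : ℝ[X]), (monic_X_pow n).sub_of_left (by rwa [degree_X_pow]), ?_, fun q hq => ?_⟩
  · refine natDegree_eq_of_degree_eq_some ?_
    rw [degree_sub_eq_left_of_degree_lt] <;> simp [hrd]
  · have := congrArg (fun f => f ⟨q, mem_degreeLT.2 hq⟩) hr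
    simp only [φ, LinearMap.mk₂_apply, LinearMap.comp_apply, Submodule.subtype_apply,
      LinearMap.mulLeft_apply] at this
    rw [sub_mul, map_sub, this, sub_self]

variable {P : ℝ[X]}

/-- Split off the root, `P = (X - z) R`. If `z` lay outside the interval, `P R = (X - z) R²` would
have constant sign on it, although `L (P R) = 0` by orthogonality. -/
theorem root_mem_Ioo (hL : IsPositiveOn L a b) (hP : P.Monic)
    (horth : ∀ q : ℝ[X], q.degree < P.degree → L (P * q) = 0) {z : ℝ} (hz : P.IsRoot z) :
    z ∈ Set.Ioo a b := by
  obtain ⟨R, hR⟩ := dvd_iff_isRoot.2 hz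
  have hR0 : R ≠ 0 := by rintro rfl; simp [hP.ne_zero] at hR
  have hdeg : R.degree < P.degree := by
    rw [hR, degree_mul, degree_X_sub_C, degree_eq_natDegree hR0]
    exact_mod_cast (by omega : R.natDegree < 1 + R.natDegree)
  have h0 := horth R hdeg
  have hne : P * R ≠ 0 := mul_ne_zero hP.ne_zero hR0
  have hev : ∀ s, (P * R).eval s = (s - z) * (R.eval s * R.eval s) := fun s => by
    rw [hR]; simp; ring
  constructor
  · by_contra hza
    refine (hL.pos (P * R) hne fun s hs => ?_).ne' h0
    rw [hev]
    exact mul_nonneg (by linarith [hs.1, not_lt.1 hza]) (mul_self_nonneg _)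
  · by_contra hzb
    have h1 := hL.pos (-(P * R)) (neg_ne_zero.2 hne) fun s hs => by
      rw [eval_neg, hev, ← neg_mul]
      exact mul_nonneg (by linarith [hs.2, not_lt.1 hzb]) (mul_self_nonneg _)
    rw [map_neg, h0] at h1
    simp at h1

/-- A double root gives `P = (X - z)² R`, and then `P R` is a nonzero square annihilated by `L`. -/
theorem roots_nodup (hL : IsPositiveOn L a b) (hP : P.Monic)
    (horth : ∀ q : ℝ[X], q.degree < P.degree → L (P * q) = 0) : P.roots.Nodup := by
  rw [Multiset.nodup_iff_count_le_one]
  intro z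
  rw [count_roots]
  by_contra hlt
  obtain ⟨R, hR⟩ := (pow_dvd_pow (X - C z) (not_le.1 hlt)).trans (pow_rootMultiplicity_dvd P z)
  have hR0 : R ≠ 0 := by rintro rfl; simp [hP.ne_zero] at hR
  have hdeg : R.degree < P.degree := by
    refine degree_lt_degree ?_
    rw [hR, natDegree_mul (pow_ne_zero _ (X_sub_C_ne_zero z)) hR0, natDegree_pow, natDegree_X_sub_C]
    omega
  refine (hL.pos (P * R) (mul_ne_zero hP.ne_zero hR0) fun s _ => ?_).ne' (horth R hdeg)
  have : (P * R).eval s = ((s - z) * R.eval s) ^ 2 := by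
    rw [hR]; simp; ring
  rw [this]; positivity

theorem _root_.Polynomial.eval_pos_or_neg_of_roots_eq_zero {q : ℝ[X]} (hq : q ≠ 0)
    (hr : q.roots = 0) : (∀ s, 0 < q.eval s) ∨ ∀ s, q.eval s < 0 := by
  have hne : ∀ s, q.eval s ≠ 0 := fun s hs => by
    have : s ∈ q.roots := (mem_roots hq).2 hs
    simp [hr] at this
  by_contra! ⟨⟨s, hs⟩, t, ht⟩
  obtain ⟨u, -, hu⟩ := intermediate_value_uIcc (a := s) (b := t) q.continuous.continuousOn
    (Set.Icc_subset_uIcc ⟨hs, ht⟩)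
  exact hne u hu

/-- Let `S` collect the real roots, `P = S q`. The cofactor `q` has no real root, hence a fixed
sign, and so does `P S = S² q`. If `S` had smaller degree than `P`, orthogonality would force `L (P
S) = 0`. -/
theorem card_roots_eq (hL : IsPositiveOn L a b) (hP : P.Monic)
    (horth : ∀ q : ℝ[X], q.degree < P.degree → L (P * q) = 0) :
    Multiset.card P.roots = P.natDegree := by
  obtain ⟨q, hq, hcard, hroots⟩ := exists_prod_multiset_X_sub_C_mul P
  by_contra hne
  have hq0 : q ≠ 0 := by rintro rfl; simp [hP.ne_zero.symm] at hq
  set S := (P.roots.map fun a => X - C a).prod with hS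
  have hSm : S.Monic := monic_multiset_prod_of_monic _ _ fun z _ => monic_X_sub_C z
  have hdeg : S.degree < P.degree := by
    rw [degree_eq_natDegree hSm.ne_zero, degree_eq_natDegree hP.ne_zero, hS,
      natDegree_multiset_prod_X_sub_C_eq_card]
    exact_mod_cast (by omega)
  have h0 := horth S hdeg
  have hev : ∀ s, (P * S).eval s = S.eval s ^ 2 * q.eval s := fun s => by
    rw [← hq]; simp; ring
  have hne' : P * S ≠ 0 := mul_ne_zero hP.ne_zero hSm.ne_zero
  rcases eval_pos_or_neg_of_roots_eq_zero hq0 hroots with h | h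
  · refine (hL.pos (P * S) hne' fun s _ => ?_).ne' h0
    rw [hev]
    exact mul_nonneg (by positivity) (h s).le
  · have h1 := hL.pos (-(P * S)) (neg_ne_zero.2 hne') fun s _ => by
      rw [eval_neg, hev, ← mul_neg]
      exact mul_nonneg (by positivity) (by linarith [h s])
    rw [map_neg, h0] at h1
    simp at h1

/-- Existence of Gauss quadrature for a positive functional. -/
theorem exists_gauss (hL : IsPositiveOn L a b) (n : ℕ) :
    ∃ x ω : Fin n → ℝ, StrictMono x ∧ (∀ k, x k ∈ Set.Ioo a b) ∧
      ∀ p : ℝ[X], p.degree < ((2 * n : ℕ) : WithBot ℕ) → ∑ k, ω k * p.eval (x k) = L p := by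
  obtain ⟨P, hP, hPn, horth'⟩ := hL.exists_orthogonal n
  have hPd : P.degree = n := by rw [degree_eq_natDegree hP.ne_zero, hPn]
  have horth : ∀ q : ℝ[X], q.degree < P.degree → L (P * q) = 0 := by rwa [hPd]
  have hcard : P.roots.toFinset.card = n := by
    rw [Multiset.toFinset_card_of_nodup (hL.roots_nodup hP horth), hL.card_roots_eq hP horth, hPn]
  let x := P.roots.toFinset.orderEmbOfFin hcard
  have hroot : ∀ k, P.IsRoot (x k) := fun k => by
    have := P.roots.toFinset.orderEmbOfFin_mem hcard k
    rw [Multiset.mem_toFinset, mem_roots hP.ne_zero] at this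
    exact this
  have hinj : Set.InjOn (x : Fin n → ℝ) (Finset.univ : Finset (Fin n)) :=
    x.strictMono.injective.injOn
  refine ⟨x, fun k => L (Lagrange.basis Finset.univ x k), x.strictMono,
    fun k => hL.root_mem_Ioo hP horth (hroot k), fun p hp => ?_⟩
  -- Quotient and remainder modulo `P` both have degree `< n`. The quotient part `P * (p /ₘ P)`
  -- vanishes at the nodes and is annihilated by `L`, and the remainder equals its Lagrange
  -- interpolant.
  have hdiv := modByMonic_add_div p P
  have hrd : (p %ₘ P).degree < n := hPd ▸ degree_modByMonic_lt p hP
  have hqd : (p /ₘ P).degree < n := by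
    by_cases hle : P.degree ≤ p.degree
    · have := degree_add_divByMonic hP hle
      by_cases hp0 : p /ₘ P = 0
      · simp [hp0]
      rw [hPd, degree_eq_natDegree hp0] at this
      rw [← this] at hp
      rw [degree_eq_natDegree hp0]
      norm_cast at hp ⊢
      omega
    · rw [(divByMonic_eq_zero_iff hP).2 (not_le.1 hle)]
      simp
  have hev : ∀ k, p.eval (x k) = (p %ₘ P).eval (x k) := fun k => by
    conv_lhs => rw [← hdiv]
    rw [eval_add, eval_mul, (hroot k).eq_zero, zero_mul, add_zero]
  have hr := Lagrange.eq_interpolate hinj (f := p %ₘ P) (by simpa using hrd)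
  conv_rhs => rw [← hdiv, map_add, horth' _ hqd, add_zero, hr, Lagrange.interpolate_apply, map_sum]
  refine Finset.sum_congr rfl fun k _ => ?_
  rw [hev, mul_comm, ← smul_eq_C_mul, map_smul, smul_eq_mul]

variable {n : ℕ} {x ω : Fin n → ℝ}

/-- The squared Lagrange basis polynomial has degree `2n - 2`, so the rule is exact for it and
returns precisely `ω k`. -/
theorem gauss_weight_pos (hL : IsPositiveOn L a b) (hx : StrictMono x)
    (hex : ∀ p : ℝ[X], p.degree < ((2 * n : ℕ) : WithBot ℕ) → ∑ k, ω k * p.eval (x k) = L p)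
    (k : Fin n) : 0 < ω k := by
  have hinj : Set.InjOn x (Finset.univ : Finset (Fin n)) := hx.injective.injOn
  set l := Lagrange.basis Finset.univ x k with hl
  have hl0 : l ≠ 0 := Lagrange.basis_ne_zero hinj (Finset.mem_univ k)
  have h := hex (l * l) (by
    have := k.2
    rw [degree_mul, hl, Lagrange.degree_basis hinj (Finset.mem_univ k)]
    simp only [Finset.card_univ, Fintype.card_fin]
    norm_cast
    omega)
  rw [Finset.sum_eq_single k] at h
  · rw [eval_mul, hl, Lagrange.eval_basis_self hinj (Finset.mem_univ k)] at h
    rw [← hl] at h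
    have := hL.sq_pos hl0
    linarith
  · intro j _ hj
    rw [eval_mul, hl, Lagrange.eval_basis_of_ne hj.symm (Finset.mem_univ j)]
    simp
  · simp

/-- Minimality of the nodal polynomial of a Gauss rule. -/
theorem nodal_sq_le (hL : IsPositiveOn L a b)
    (hex : ∀ p : ℝ[X], p.degree < ((2 * n : ℕ) : WithBot ℕ) → ∑ k, ω k * p.eval (x k) = L p)
    {q : ℝ[X]} (hq : q.Monic) (hqn : q.natDegree = n) :
    L (Lagrange.nodal Finset.univ x * Lagrange.nodal Finset.univ x) ≤ L (q * q) := by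
  set π := Lagrange.nodal Finset.univ x with hπ
  have hπd : π.degree = n := by simp [hπ, Lagrange.degree_nodal]
  have hqd : q.degree = n := by rw [degree_eq_natDegree hq.ne_zero, hqn]
  have hrd : (q - π).degree < n := by
    have := degree_sub_lt_left (hqd.trans hπd.symm) hq.ne_zero
      (by rw [hq.leadingCoeff, Lagrange.nodal_monic.leadingCoeff])
    rwa [hqd] at this
  -- The product has degree below `2n` and vanishes at every node, so exactness gives orthogonality.
  -- The claim is then Pythagoras for `q = π + (q - π)`.
  have h0 : L (π * (q - π)) = 0 := by
    rw [← hex]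
    · refine Finset.sum_eq_zero fun k _ => ?_
      rw [eval_mul, hπ, Lagrange.eval_nodal_at_node (Finset.mem_univ k)]
      simp
    · by_cases hr : q - π = 0
      · rw [hr, mul_zero, degree_zero]; exact WithBot.bot_lt_coe _
      rw [degree_mul, hπd]
      rw [degree_eq_natDegree hr] at hrd ⊢
      norm_cast at hrd ⊢
      omega
  have h1 : q * q = π * π + (2 : ℝ) • (π * (q - π)) + (q - π) * (q - π) := by
    rw [ofNat_smul_eq_nsmul, nsmul_eq_mul]; push_cast; ring
  rw [h1, map_add, map_add, map_smul, h0]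
  have := hL.sq_nonneg (q - π)
  simpa using this

end IsPositiveOn

/-! ### Rolle's theorem and the Hermite interpolation error -/

/-- Rolle's theorem for a finite set of zeros: the derivative vanishes at a point strictly between
any two consecutive ones. -/
theorem exists_zeros_deriv_disjoint {a b : ℝ} {g g' : ℝ → ℝ}
    (hg : ∀ x ∈ Set.Icc a b, HasDerivAt g (g' x) x) (S : Finset ℝ) :
    (∀ x ∈ S, x ∈ Set.Icc a b ∧ g x = 0) →
    ∃ S' : Finset ℝ, S.card ≤ S'.card + 1 ∧ Disjoint S S' ∧
      (∀ x ∈ S', x ∈ Set.Icc a b ∧ g' x = 0) ∧ ∀ y ∈ S', ∃ x ∈ S, y < x := by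
  induction S using Finset.induction_on_max with
  | empty => exact fun _ => ⟨∅, by simp⟩
  | insert m S hm ih =>
    intro hS
    obtain ⟨S', hcard, hdisj, hz, hlt⟩ := ih fun x hx => hS x (Finset.mem_insert_of_mem hx)
    have hmS : m ∉ S := fun h => (hm m h).false
    rcases S.eq_empty_or_nonempty with rfl | hne
    · exact ⟨∅, by simp⟩
    set M := S.max' hne with hM
    have hMS : M ∈ S := S.max'_mem hne
    have hMm : M < m := hm M hMS
    obtain ⟨hMI, hM0⟩ := hS M (Finset.mem_insert_of_mem hMS)
    obtain ⟨hmI, hm0⟩ := hS m (Finset.mem_insert_self m S)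
    have hsub : Set.Icc M m ⊆ Set.Icc a b := Set.Icc_subset_Icc hMI.1 hmI.2
    obtain ⟨y, hy, hy0⟩ := exists_hasDerivAt_eq_zero (f := g) (f' := g') hMm
      (fun x hx => (hg x (hsub hx)).continuousAt.continuousWithinAt) (hM0.trans hm0.symm)
      (fun x hx => hg x (hsub (Set.Ioo_subset_Icc_self hx)))
    -- The last clause of the induction claim keeps the earlier Rolle points below `M`, so the point
    -- found in `(M, m)` is new.
    have hltM : ∀ z ∈ S', z < M := fun z hz => by
      obtain ⟨x, hx, hzx⟩ := hlt z hz
      exact hzx.trans_le (S.le_max' x hx)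
    have hyS' : y ∉ S' := fun h => (hltM y h).not_gt hy.1
    refine ⟨insert y S', ?_, ?_, ?_, ?_⟩
    · rw [Finset.card_insert_of_notMem hyS', Finset.card_insert_of_notMem hmS]; omega
    · rw [Finset.disjoint_insert_left, Finset.disjoint_insert_right, Finset.mem_insert]
      refine ⟨?_, fun h => (S.le_max' y h).not_gt hy.1, hdisj⟩
      rintro (h | h)
      · exact hy.2.ne' h
      · exact (hltM m h).not_gt hMm
    · intro x hx
      rcases Finset.mem_insert.1 hx with rfl | hx
      · exact ⟨hsub (Set.Ioo_subset_Icc_self hy), hy0⟩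
      · exact hz x hx
    · intro z hz
      refine ⟨m, Finset.mem_insert_self m S, ?_⟩
      rcases Finset.mem_insert.1 hz with rfl | hz
      · exact hy.2
      · exact (hltM z hz).trans hMm

/-- Generalized Rolle theorem. -/
theorem exists_iterate_deriv_eq_zero {a b : ℝ} (N : ℕ) {G : ℕ → ℝ → ℝ}
    (hG : ∀ k, ∀ x ∈ Set.Icc a b, HasDerivAt (G k) (G (k + 1) x) x) (S : Finset ℝ)
    (hcard : N + 1 ≤ S.card) (hS : ∀ x ∈ S, x ∈ Set.Icc a b ∧ G 0 x = 0) :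
    ∃ ξ ∈ Set.Icc a b, G N ξ = 0 := by
  induction N generalizing G S with
  | zero =>
    obtain ⟨x, hx⟩ := Finset.card_pos.1 (by omega : 0 < S.card)
    exact ⟨x, (hS x hx).1, (hS x hx).2⟩
  | succ N ih =>
    obtain ⟨S', hc, -, hz, -⟩ := exists_zeros_deriv_disjoint (hG 0) S hS
    exact ih (G := fun k => G (k + 1)) (fun k => hG (k + 1)) S' (by omega) hz

/-- Existence of the Hermite interpolation polynomial with double nodes. -/
theorem exists_hermite {n : ℕ} {x : Fin n → ℝ} (hx : Function.Injective x) (u v : Fin n → ℝ) :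
    ∃ H : ℝ[X], H.degree < ((2 * n : ℕ) : WithBot ℕ) ∧ (∀ k, H.eval (x k) = u k) ∧
      ∀ k, H.derivative.eval (x k) = v k := by
  have hinj : Set.InjOn x (Finset.univ : Finset (Fin n)) := hx.injOn
  set A := Lagrange.interpolate Finset.univ x u with hA
  set π := Lagrange.nodal Finset.univ x with hπ
  have hπ' : ∀ k, π.derivative.eval (x k) ≠ 0 := fun k => by
    rw [hπ, Lagrange.eval_nodal_derivative_eval_node_eq (Finset.mem_univ k), Lagrange.eval_nodal,
      Finset.prod_ne_zero_iff]
    intro j hj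
    exact sub_ne_zero.2 fun h => (Finset.mem_erase.1 hj).1 (hx h).symm
  -- As `π` vanishes at the nodes, adding `π * B` keeps the values of `A` there and changes its
  -- derivative by `π' B`; `B` is chosen to correct the derivatives.
  set B := Lagrange.interpolate Finset.univ x
    (fun k => (v k - A.derivative.eval (x k)) / π.derivative.eval (x k)) with hB
  have hAd : A.degree < n := (Lagrange.degree_interpolate_lt u hinj).trans_eq (by simp)
  have hBd : B.degree < n := (Lagrange.degree_interpolate_lt _ hinj).trans_eq (by simp)
  have hπd : π.degree = n := by simp [hπ, Lagrange.degree_nodal]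
  have hπ0 : ∀ k, π.eval (x k) = 0 := fun k => Lagrange.eval_nodal_at_node (Finset.mem_univ k)
  refine ⟨A + π * B, ?_, fun k => ?_, fun k => ?_⟩
  · refine (degree_add_le _ _).trans_lt (max_lt (hAd.trans_le ?_) ?_)
    · exact_mod_cast (by omega : n ≤ 2 * n)
    · by_cases hB0 : B = 0
      · rw [hB0, mul_zero, degree_zero]; exact WithBot.bot_lt_coe _
      rw [degree_mul, hπd]
      rw [degree_eq_natDegree hB0] at hBd ⊢
      norm_cast at hBd ⊢
      omega
  · rw [eval_add, eval_mul, hπ0, zero_mul, add_zero, hA,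
      Lagrange.eval_interpolate_at_node u hinj (Finset.mem_univ k)]
  · rw [derivative_add, derivative_mul, eval_add, eval_add, eval_mul, eval_mul, hπ0, zero_mul,
      add_zero, hB, Lagrange.eval_interpolate_at_node _ hinj (Finset.mem_univ k),
      mul_div_cancel₀ _ (hπ' k)]
    ring

/-- Error estimate for Hermite interpolation with double nodes. -/
theorem abs_sub_hermite_le {a b M : ℝ} {n : ℕ} {x : Fin n → ℝ} (hx : Function.Injective x)
    (hxI : ∀ k, x k ∈ Set.Icc a b) {F : ℕ → ℝ → ℝ}
    (hF : ∀ k, ∀ s ∈ Set.Icc a b, HasDerivAt (F k) (F (k + 1) s) s)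
    (hM : ∀ s ∈ Set.Icc a b, |F (2 * n) s| ≤ M) {H : ℝ[X]}
    (hHd : H.degree < ((2 * n : ℕ) : WithBot ℕ)) (hH : ∀ k, H.eval (x k) = F 0 (x k))
    (hH' : ∀ k, H.derivative.eval (x k) = F 1 (x k)) {s : ℝ} (hs : s ∈ Set.Icc a b) :
    |F 0 s - H.eval s| ≤ M / (2 * n).factorial *
      (Lagrange.nodal Finset.univ x * Lagrange.nodal Finset.univ x).eval s := by
  set π := Lagrange.nodal Finset.univ x with hπ
  have hπ0 : ∀ k, π.eval (x k) = 0 := fun k => Lagrange.eval_nodal_at_node (Finset.mem_univ k)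
  by_cases hsx : ∃ k, x k = s
  · obtain ⟨k, rfl⟩ := hsx
    simp [hH, hπ0]
  push Not at hsx
  have hπs : π.eval s ≠ 0 := by
    rw [hπ, Lagrange.eval_nodal, Finset.prod_ne_zero_iff]
    exact fun k _ => sub_ne_zero.2 (hsx k).symm
  have hπs2 : (π * π).eval s ≠ 0 := by rw [eval_mul]; exact mul_ne_zero hπs hπs
  -- This choice makes `F 0 - H - K π²` vanish at `s` as well as at the nodes.
  set K := (F 0 s - H.eval s) / (π * π).eval s with hK
  let p : ℝ[X] := H + C K * (π * π)
  let G : ℕ → ℝ → ℝ := fun k y => F k y - (derivative^[k] p).eval y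
  have hG : ∀ k, ∀ y ∈ Set.Icc a b, HasDerivAt (G k) (G (k + 1) y) y := fun k y hy => by
    have := (derivative^[k] p).hasDerivAt y
    rw [← Function.iterate_succ_apply' derivative k p] at this
    exact (hF k y hy).sub this
  let Z : Finset ℝ := Finset.univ.image x
  have hZc : Z.card = n := by rw [Finset.card_image_of_injective _ hx]; simp
  have hsZ : s ∉ Z := by simpa [Z] using hsx
  have hp' : p.derivative = H.derivative + C K * (π.derivative * π + π * π.derivative) := by
    simp [p]
  obtain ⟨S', hcard, hdisj, hz, -⟩ := exists_zeros_deriv_disjoint (hG 0) (insert s Z) (by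
    intro y hy
    rcases Finset.mem_insert.1 hy with rfl | hy
    · refine ⟨hs, ?_⟩
      simp only [G, p, Function.iterate_zero, id, eval_add, eval_mul, eval_C]
      rw [hK, ← eval_mul, div_mul_cancel₀ _ hπs2]
      ring
    · obtain ⟨k, -, rfl⟩ := Finset.mem_image.1 hy
      refine ⟨hxI k, ?_⟩
      simp [G, p, hH, hπ0])
  rw [Finset.card_insert_of_notMem hsZ, hZc] at hcard
  have hn : ∃ ξ ∈ Set.Icc a b, G (2 * n) ξ = 0 := by
    rcases Nat.eq_zero_or_pos n with rfl | hn
    · refine ⟨s, hs, ?_⟩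
      simp only [G, p, Function.iterate_zero, id, eval_add, eval_mul, eval_C, mul_zero]
      rw [hK, ← eval_mul, div_mul_cancel₀ _ hπs2]
      ring
    -- The `n` Rolle points avoid the nodes, where the derivative vanishes too because they are
    -- double zeros. That is `2n` zeros of `G 1`, enough for `2n - 1` further derivatives.
    · have := exists_iterate_deriv_eq_zero (2 * n - 1) (G := fun k => G (k + 1))
        (fun k => hG (k + 1)) (S' ∪ Z) (by
          rw [Finset.card_union_of_disjoint, hZc]
          · omega
          · exact (Finset.disjoint_insert_left.1 hdisj).2.symm) (by
          intro y hy
          rcases Finset.mem_union.1 hy with hy | hy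
          · exact hz y hy
          · obtain ⟨k, -, rfl⟩ := Finset.mem_image.1 hy
            refine ⟨hxI k, ?_⟩
            simp only [G, Function.iterate_succ, Function.iterate_zero, Function.comp, id, hp']
            simp [hH', hπ0])
      simpa [show 2 * n - 1 + 1 = 2 * n by omega] using this
  obtain ⟨ξ, hξ, hξ0⟩ := hn
  have hππ : (π * π).Monic := Lagrange.nodal_monic.mul Lagrange.nodal_monic
  have hππd : (π * π).natDegree = 2 * n := by
    rw [natDegree_mul Lagrange.nodal_ne_zero Lagrange.nodal_ne_zero, Lagrange.natDegree_nodal]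
    simp; ring
  have hd : derivative^[2 * n] p = C (K * (2 * n).factorial) := by
    have h1 : derivative^[2 * n] H = 0 := by
      by_cases hH0 : H = 0
      · simp [hH0]
      · refine iterate_derivative_eq_zero ?_
        rw [degree_eq_natDegree hH0] at hHd
        exact_mod_cast hHd
    have h2 : derivative^[2 * n] (π * π) = C ((2 * n).factorial : ℝ) := by
      have hdeg : (derivative^[2 * n] (π * π)).natDegree = 0 := by
        have := natDegree_iterate_derivative (π * π) (2 * n)
        omega
      rw [eq_C_of_natDegree_eq_zero hdeg, coeff_iterate_derivative, zero_add,
        Nat.descFactorial_self, ← hππd, hππ.coeff_natDegree]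
      simp
    simp only [p]
    rw [iterate_map_add, iterate_derivative_C_mul, h1, h2, zero_add, C_mul]
  have hKe : F (2 * n) ξ = K * (2 * n).factorial := by
    have := hξ0
    simp only [G, hd, eval_C] at this
    linarith
  have hfac : (0 : ℝ) < (2 * n).factorial := by positivity
  have hKM : |K| ≤ M / (2 * n).factorial := by
    rw [le_div_iff₀ hfac, ← abs_of_pos hfac, ← abs_mul, ← hKe]
    exact hM ξ hξ
  have hfin : F 0 s - H.eval s = K * (π * π).eval s := by rw [hK, div_mul_cancel₀ _ hπs2]
  have hnn : 0 ≤ (π * π).eval s := by rw [eval_mul]; exact mul_self_nonneg _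
  rw [hfin, abs_mul, abs_of_nonneg hnn]
  exact mul_le_mul_of_nonneg_right hKM hnn

/-! ### Weight functions and the general Gauss error bound -/

section Weight

variable {ρ : ℝ → ℝ} {a b : ℝ}

theorem intervalIntegrable_mul_eval (hρ : IntervalIntegrable ρ MeasureTheory.volume a b)
    (p : ℝ[X]) : IntervalIntegrable (fun s => ρ s * p.eval s) MeasureTheory.volume a b :=
  hρ.mul_continuousOn p.continuous.continuousOn

/-- Integration of polynomials against a weight function. -/
noncomputable def weightFunctional (hρ : IntervalIntegrable ρ MeasureTheory.volume a b) :
    ℝ[X] →ₗ[ℝ] ℝ where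
  toFun p := ∫ s in a..b, ρ s * p.eval s
  map_add' p q := by
    rw [← intervalIntegral.integral_add (intervalIntegrable_mul_eval hρ p)
      (intervalIntegrable_mul_eval hρ q)]
    simp [mul_add]
  map_smul' c p := by
    rw [RingHom.id_apply, smul_eq_mul, ← intervalIntegral.integral_const_mul]
    congr 1; ext s
    simp; ring

theorem weightFunctional_apply (hρ : IntervalIntegrable ρ MeasureTheory.volume a b) (p : ℝ[X]) :
    weightFunctional hρ p = ∫ s in a..b, ρ s * p.eval s := rfl

/-- The integrand is nonnegative and can vanish on the open interval only at the finitely many roots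
of `p`, so its support has positive measure. -/
theorem isPositiveOn_weightFunctional (hab : a < b)
    (hρ : IntervalIntegrable ρ MeasureTheory.volume a b) (hpos : ∀ s ∈ Set.Ioo a b, 0 < ρ s) :
    IsPositiveOn (weightFunctional hρ) a b := by
  refine ⟨hab, fun p hp hnn => ?_⟩
  rw [weightFunctional_apply, intervalIntegral.integral_pos_iff_support_of_nonneg_ae' ?_
    (intervalIntegrable_mul_eval hρ p)]
  · refine ⟨hab, ?_⟩
    have hsub : Set.Ioo a b \ (p.roots.toFinset : Set ℝ) ⊆
        (Function.support fun s => ρ s * p.eval s) ∩ Set.Ioc a b := fun s hs => by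
      refine ⟨?_, Set.Ioo_subset_Ioc_self hs.1⟩
      have h2 : s ∉ p.roots := by simpa using hs.2
      exact mul_ne_zero (hpos s hs.1).ne' fun h => h2 ((mem_roots hp).2 h)
    refine lt_of_lt_of_le ?_ (MeasureTheory.measure_mono hsub)
    rw [MeasureTheory.measure_sdiff_null (p.roots.toFinset.finite_toSet.measure_zero _)]
    simpa using hab
  · rw [Set.uIoc_of_le hab.le, ← MeasureTheory.restrict_Ioo_eq_restrict_Ioc]
    filter_upwards [MeasureTheory.ae_restrict_mem measurableSet_Ioo] with s hs
    exact mul_nonneg (hpos s hs).le (hnn s hs)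

theorem exists_isGaussRule (hab : a < b) (hρ : IntervalIntegrable ρ MeasureTheory.volume a b)
    (hpos : ∀ s ∈ Set.Ioo a b, 0 < ρ s) (n : ℕ) :
    ∃ x ω : Fin n → ℝ, IsGaussRule ρ a b x ω :=
  (isPositiveOn_weightFunctional hab hρ hpos).exists_gauss n

theorem IsGaussRule.weight_pos {n : ℕ} {x ω : Fin n → ℝ} (h : IsGaussRule ρ a b x ω)
    (hab : a < b) (hρ : IntervalIntegrable ρ MeasureTheory.volume a b)
    (hpos : ∀ s ∈ Set.Ioo a b, 0 < ρ s) (k : Fin n) : 0 < ω k :=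
  (isPositiveOn_weightFunctional hab hρ hpos).gauss_weight_pos h.1 h.2.2 k

/-- Error of Gauss quadrature in terms of a bound of the derivative of order `2 * n` and of a monic
comparison polynomial of degree `n`. -/
theorem IsGaussRule.error_le {M : ℝ} {n : ℕ} {x ω : Fin n → ℝ} (h : IsGaussRule ρ a b x ω)
    (hab : a < b) (hρ : IntervalIntegrable ρ MeasureTheory.volume a b)
    (hpos : ∀ s ∈ Set.Ioo a b, 0 < ρ s) {F : ℕ → ℝ → ℝ}
    (hF : ∀ k, ∀ s ∈ Set.Icc a b, HasDerivAt (F k) (F (k + 1) s) s)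
    (hM : ∀ s ∈ Set.Icc a b, |F (2 * n) s| ≤ M) {q : ℝ[X]} (hq : q.Monic)
    (hqn : q.natDegree = n) :
    |(∫ s in a..b, ρ s * F 0 s) - ∑ k, ω k * F 0 (x k)| ≤
      M / (2 * n).factorial * ∫ s in a..b, ρ s * (q * q).eval s := by
  have hL := isPositiveOn_weightFunctional hab hρ hpos
  obtain ⟨hmono, hxI, hex⟩ := h
  obtain ⟨H, hHd, hH, hH'⟩ := exists_hermite hmono.injective (fun k => F 0 (x k))
    (fun k => F 1 (x k))
  have hM0 : 0 ≤ M := (abs_nonneg _).trans (hM a (Set.left_mem_Icc.2 hab.le))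
  set π := Lagrange.nodal Finset.univ x with hπ
  have hF0 : ContinuousOn (F 0) (Set.uIcc a b) := by
    rw [Set.uIcc_of_le hab.le]
    exact fun s hs => (hF 0 s hs).continuousAt.continuousWithinAt
  have hsum : ∑ k, ω k * F 0 (x k) = ∫ s in a..b, ρ s * H.eval s := by
    rw [← hex H hHd]
    simp [hH]
  have hi1 := hρ.mul_continuousOn hF0
  have hi2 := intervalIntegrable_mul_eval hρ H
  rw [hsum, ← intervalIntegral.integral_sub hi1 hi2]
  have hi3 := intervalIntegrable_mul_eval hρ (π * π)
  calc |∫ s in a..b, (ρ s * F 0 s - ρ s * H.eval s)|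
      ≤ ∫ s in a..b, |ρ s * F 0 s - ρ s * H.eval s| :=
        intervalIntegral.abs_integral_le_integral_abs hab.le
    _ ≤ ∫ s in a..b, M / (2 * n).factorial * (ρ s * (π * π).eval s) := by
        refine intervalIntegral.integral_mono_on_of_le_Ioo hab.le (hi1.sub hi2).abs
          (hi3.const_mul _) fun s hs => ?_
        rw [← mul_sub, abs_mul, abs_of_pos (hpos s hs), mul_left_comm]
        exact mul_le_mul_of_nonneg_left (abs_sub_hermite_le hmono.injective
          (fun k => Set.Ioo_subset_Icc_self (hxI k)) hF hM hHd hH hH'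
          (Set.Ioo_subset_Icc_self hs)) (hpos s hs).le
    _ = M / (2 * n).factorial * ∫ s in a..b, ρ s * (π * π).eval s :=
        intervalIntegral.integral_const_mul _ _
    _ ≤ _ := mul_le_mul_of_nonneg_left (hL.nodal_sq_le hex hq hqn) (by positivity)

end Weight

/-! ### Chebyshev competitors and derivative bounds -/

/-- Monic Chebyshev polynomials on `[a, b]`. -/
theorem exists_monic_abs_eval_le {a b : ℝ} (hab : a < b) {n : ℕ} (hn : 1 ≤ n) :
    ∃ q : ℝ[X], q.Monic ∧ q.natDegree = n ∧
      ∀ s ∈ Set.Icc a b, |q.eval s| ≤ 2 * ((b - a) / 4) ^ n := by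
  have hd : 0 < b - a := sub_pos.2 hab
  -- The affine map from `[a, b]` onto `[-1, 1]`. Its slope `2 / (b - a)` and the leading
  -- coefficient `2 ^ (n - 1)` of the Chebyshev polynomial fix the normalising factor.
  set l : ℝ[X] := C (2 / (b - a)) * X + C (-((a + b) / (b - a))) with hl
  have hl2 : (2 / (b - a)) ≠ 0 := by positivity
  have hld : l.natDegree = 1 := natDegree_linear hl2
  have hll : l.leadingCoeff = 2 / (b - a) := leadingCoeff_linear hl2
  have hc : (2 * ((b - a) / 4) ^ n : ℝ) ≠ 0 := by positivity
  refine ⟨C (2 * ((b - a) / 4) ^ n) * (Chebyshev.T ℝ n).comp l, ?_, ?_, fun s hs => ?_⟩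
  · rw [Monic, leadingCoeff_mul, leadingCoeff_C, leadingCoeff_comp (by omega), hll,
      Chebyshev.leadingCoeff_T, Chebyshev.natDegree_T, Int.natAbs_natCast]
    obtain ⟨k, rfl⟩ : ∃ k, n = k + 1 := ⟨n - 1, by omega⟩
    have h1 : (b - a) / 4 * (2 / (b - a)) = 1 / 2 := by field_simp; norm_num
    calc _ = 2 ^ (k + 1) * ((b - a) / 4 * (2 / (b - a))) ^ (k + 1) := by
          rw [Nat.add_sub_cancel, mul_pow, pow_succ (2 : ℝ) k]; ring
      _ = 1 := by rw [h1, ← mul_pow]; norm_num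
  · rw [natDegree_C_mul hc, natDegree_comp, hld, Chebyshev.natDegree_T]
    simp
  · rw [eval_mul, eval_C, eval_comp, abs_mul, abs_of_nonneg (by positivity)]
    refine mul_le_of_le_one_right (by positivity) (Chebyshev.abs_eval_T_real_le_one n ?_)
    have : l.eval s = (2 * s - (a + b)) / (b - a) := by
      simp [hl]; field_simp; ring
    rw [this, abs_le, le_div_iff₀ hd, div_le_iff₀ hd]
    constructor <;> linarith [hs.1, hs.2]

/-- The factor `|α - 1 - k|` is at most `k + 1` once `k + 1 ≥ A`; each of the at most `⌈A⌉₊` earlier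
factors costs an extra `max 1 A`. This bounds the derivatives of `s ^ (α - 1)` uniformly in `α ≤ A`.
-/
theorem abs_eval_descPochhammer_le {α A : ℝ} (hα : 0 < α) (hαA : α ≤ A) (k : ℕ) :
    |(descPochhammer ℝ k).eval (α - 1)| ≤ max 1 A ^ min k ⌈A⌉₊ * k.factorial := by
  induction k with
  | zero => simp
  | succ k ih =>
    have h1 : (1 : ℝ) ≤ max 1 A := le_max_left _ _
    have hk : (0 : ℝ) ≤ k := k.cast_nonneg
    rw [descPochhammer_succ_eval, abs_mul, Nat.factorial_succ]
    push_cast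
    rcases le_or_gt (k + 1) ⌈A⌉₊ with h | h
    · rw [min_eq_left h, pow_succ]
      rw [min_eq_left (by omega)] at ih
      have h2 : |α - 1 - k| ≤ max 1 A * (k + 1) := by
        have : A ≤ max 1 A := le_max_right _ _
        rw [abs_le]
        constructor <;> nlinarith
      calc _ ≤ (max 1 A ^ k * k.factorial) * (max 1 A * (k + 1)) := by gcongr
        _ = _ := by ring
    · rw [min_eq_right h.le]
      rw [min_eq_right (by omega)] at ih
      have h2 : |α - 1 - k| ≤ k + 1 := by
        have h3 : A ≤ k + 1 := (Nat.le_ceil A).trans (by exact_mod_cast h.le)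
        rw [abs_le]
        constructor <;> linarith
      calc _ ≤ (max 1 A ^ ⌈A⌉₊ * k.factorial) * (k + 1) := by gcongr
        _ = _ := by ring

theorem abs_eval_descPochhammer_le_factorial {α : ℝ} (hα : 0 < α) (hα1 : α < 1) (k : ℕ) :
    |(descPochhammer ℝ k).eval (α - 1)| ≤ 1 * k.factorial := by
  simpa using abs_eval_descPochhammer_le hα hα1.le k

theorem analyticAt_exp_mul_rpow (t β : ℝ) {s : ℝ} (hs : 0 < s) :
    AnalyticAt ℝ ((fun s => Real.exp (-t * s)) * fun s => s ^ β) s := by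
  have h1 : ContDiffAt ℝ ⊤ (fun s : ℝ => Real.exp (-t * s)) s := by fun_prop
  have h2 : ContDiffAt ℝ ⊤ (fun s : ℝ => s ^ β) s := Real.contDiffAt_rpow_const_of_ne hs.ne'
  exact (h1.mul h2).analyticAt

/-- In the Leibniz sum the binomial coefficients cancel against the factorials from `hK`, leaving a
partial sum of `exp (t s)`, which the factor `exp (-t s)` absorbs. Hence the bound does not depend
on `t`. -/
theorem abs_iteratedDeriv_exp_mul_rpow_le {α K t s : ℝ}
    (hK : ∀ k, |(descPochhammer ℝ k).eval (α - 1)| ≤ K * k.factorial) (ht : 0 ≤ t) (hs : 0 < s)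
    (N : ℕ) :
    |iteratedDeriv N ((fun s => Real.exp (-t * s)) * fun s => s ^ (α - 1)) s| ≤
      K * N.factorial * s ^ (α - 1 - N) := by
  have hK0 : 0 ≤ K := by simpa using (abs_nonneg _).trans (hK 0)
  rw [iteratedDeriv_mul (by fun_prop) (Real.contDiffAt_rpow_const_of_ne hs.ne')]
  calc _ ≤ ∑ i ∈ Finset.range (N + 1), K * N.factorial * s ^ (α - 1 - N) * Real.exp (-t * s) *
        ((t * s) ^ i / i.factorial) := by
        refine (Finset.abs_sum_le_sum_abs _ _).trans (Finset.sum_le_sum fun i hi => ?_)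
        have hiN : i ≤ N := Finset.mem_range_succ_iff.1 hi
        rw [iteratedDeriv_exp_const_mul, iteratedDeriv_eq_iterate, Real.iter_deriv_rpow_const,
          abs_mul, abs_mul, abs_mul, abs_mul, abs_pow, abs_neg, abs_of_nonneg ht, Nat.abs_cast,
          Real.abs_exp, abs_of_pos (Real.rpow_pos_of_pos hs _)]
        have h1 : s ^ (α - 1 - ((N - i : ℕ) : ℝ)) = s ^ (α - 1 - N) * s ^ i := by
          rw [Nat.cast_sub hiN, ← Real.rpow_natCast, ← Real.rpow_add hs]
          ring_nf
        have h2 : (N.factorial : ℝ) = N.choose i * i.factorial * (N - i).factorial := by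
          exact_mod_cast (Nat.choose_mul_factorial_mul_factorial hiN).symm
        have h3 : (0 : ℝ) < i.factorial := by positivity
        rw [h1]
        calc _ ≤ (N.choose i : ℝ) * (t ^ i * Real.exp (-t * s)) *
              ((K * (N - i).factorial) * (s ^ (α - 1 - N) * s ^ i)) := by
              gcongr
              exact hK _
          _ = _ := by rw [h2, mul_pow]; field_simp
    _ = K * N.factorial * s ^ (α - 1 - N) * (Real.exp (-t * s) *
          ∑ i ∈ Finset.range (N + 1), (t * s) ^ i / i.factorial) := by
        rw [Finset.mul_sum, Finset.mul_sum]
        exact Finset.sum_congr rfl fun i _ => by ring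
    _ ≤ K * N.factorial * s ^ (α - 1 - N) * 1 := by
        gcongr
        calc _ ≤ Real.exp (-t * s) * Real.exp (t * s) := by
              gcongr
              exact Real.sum_le_exp_of_nonneg (by positivity) _
          _ = 1 := by rw [← Real.exp_add]; simp
    _ = _ := mul_one _

/-! ### Errors of the Legendre and Jacobi rules -/

/-- Error of the Gauss–Legendre rule on a dyadic interval. -/
theorem IsGaussLegendre.error_le {α K t c : ℝ} {n : ℕ} {x ω : Fin n → ℝ}
    (h : IsGaussLegendre c (2 * c) x ω) (hc : 0 < c) (hn : 1 ≤ n) (ht : 0 ≤ t)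
    (hK : ∀ k, |(descPochhammer ℝ k).eval (α - 1)| ≤ K * k.factorial) (hαn : α - 1 ≤ 2 * n) :
    |(∫ s in c..2 * c, Real.exp (-(s * t)) * s ^ (α - 1)) -
      ∑ k, ω k * x k ^ (α - 1) * Real.exp (-(x k * t))| ≤ 4 * K * c ^ α / 16 ^ n := by
  have hK0 : 0 ≤ K := by simpa using (abs_nonneg _).trans (hK 0)
  have hcc : c < 2 * c := by linarith
  obtain ⟨q, hq, hqn, hqb⟩ := exists_monic_abs_eval_le hcc hn
  set f : ℝ → ℝ := (fun s => Real.exp (-t * s)) * fun s => s ^ (α - 1) with hf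
  have hfe : ∀ s, f s = Real.exp (-(s * t)) * s ^ (α - 1) := fun s => by
    simp only [hf, Pi.mul_apply]; ring_nf
  have hF : ∀ k, ∀ s ∈ Set.Icc c (2 * c),
      HasDerivAt (iteratedDeriv k f) (iteratedDeriv (k + 1) f s) s := fun k s hs => by
    have h1 := (analyticAt_exp_mul_rpow t (α - 1) (hc.trans_le hs.1)).iterated_deriv k
    rw [iteratedDeriv_succ, iteratedDeriv_eq_iterate]
    exact h1.differentiableAt.hasDerivAt
  have hM : ∀ s ∈ Set.Icc c (2 * c),
      |iteratedDeriv (2 * n) f s| ≤ K * (2 * n).factorial * c ^ (α - 1 - (2 * n : ℕ)) := by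
    intro s hs
    refine (abs_iteratedDeriv_exp_mul_rpow_le hK ht (hc.trans_le hs.1) _).trans ?_
    refine mul_le_mul_of_nonneg_left ?_ (by positivity)
    -- By `hαn` the exponent is nonpositive, so the left endpoint is the worst point.
    exact Real.rpow_le_rpow_of_nonpos hc hs.1 (by push_cast; linarith)
  have hρ : IntervalIntegrable (fun _ : ℝ => (1 : ℝ)) MeasureTheory.volume c (2 * c) :=
    intervalIntegrable_const
  have key := IsGaussRule.error_le h hcc hρ (fun _ _ => one_pos) hF hM hq hqn
  have hint : ∫ s in c..2 * c, (1 : ℝ) * (q * q).eval s ≤ c * (2 * (c / 4) ^ n) ^ 2 := by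
    calc _ ≤ ∫ s in c..2 * c, (2 * (c / 4) ^ n) ^ 2 := by
          refine intervalIntegral.integral_mono_on hcc.le (intervalIntegrable_mul_eval hρ _)
            intervalIntegrable_const fun s hs => ?_
          rw [one_mul, eval_mul, ← pow_two, ← sq_abs]
          have := hqb s hs
          rw [show 2 * c - c = c by ring] at this
          gcongr
      _ = _ := by rw [intervalIntegral.integral_const, smul_eq_mul]; ring
  have hL : (∫ s in c..2 * c, (1 : ℝ) * iteratedDeriv 0 f s) =
      ∫ s in c..2 * c, Real.exp (-(s * t)) * s ^ (α - 1) := by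
    simp [iteratedDeriv_zero, hfe]
  have hR : ∑ k, ω k * iteratedDeriv 0 f (x k) =
      ∑ k, ω k * x k ^ (α - 1) * Real.exp (-(x k * t)) := by
    refine Finset.sum_congr rfl fun k _ => ?_
    rw [iteratedDeriv_zero, hfe]; ring
  rw [hL, hR] at key
  refine key.trans ?_
  have hfac : (0 : ℝ) < (2 * n).factorial := by positivity
  calc _ ≤ K * (2 * n).factorial * c ^ (α - 1 - (2 * n : ℕ)) / (2 * n).factorial *
        (c * (2 * (c / 4) ^ n) ^ 2) := by gcongr
    _ = K * c ^ (α - 1 - (2 * n : ℕ)) * (c * (2 * (c / 4) ^ n) ^ 2) := by field_simp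
    _ = _ := by
      rw [show α - 1 - ((2 * n : ℕ) : ℝ) = α - (2 * n + 1 : ℕ) by push_cast; ring,
        Real.rpow_sub_natCast hc.ne', mul_pow, ← pow_mul, div_pow,
        show (4 : ℝ) ^ (n * 2) = 16 ^ n by rw [mul_comm, pow_mul]; norm_num]
      field_simp
      ring

theorem intervalIntegrable_rpow_sub_one {α a : ℝ} (hα : 0 < α) :
    IntervalIntegrable (fun s : ℝ => s ^ (α - 1)) MeasureTheory.volume 0 a :=
  intervalIntegral.intervalIntegrable_rpow' (by linarith)

/-- Error of the Gauss–Jacobi rule. -/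
theorem IsGaussJacobi.error_le {α t a : ℝ} {n : ℕ} {x ω : Fin n → ℝ}
    (h : IsGaussJacobi α a x ω) (hα : 0 < α) (ha : 0 < a) (hn : 2 ≤ n) (ht : 0 ≤ t) :
    |(∫ s in (0 : ℝ)..a, Real.exp (-(s * t)) * s ^ (α - 1)) -
      ∑ k, ω k * Real.exp (-(x k * t))| ≤
      64 * a ^ α * (a * t / 4) ^ (2 * n) / ((α + 2) * (2 * n).factorial) := by
  -- The competitor is `X` times a Chebyshev polynomial of degree `n - 1`. The extra `s²` turns the
  -- weight into `s ^ (α + 1)`, so the denominator is `α + 2` and not `α`, which would blow up as `α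
  -- → 0`. The lost degree accounts for the constant `64 = 4 * 16`.
  obtain ⟨m, rfl⟩ : ∃ m, n = m + 1 := ⟨n - 1, by omega⟩
  obtain ⟨q, hq, hqn, hqb⟩ := exists_monic_abs_eval_le ha (n := m) (by omega)
  set F : ℕ → ℝ → ℝ := fun k s => (-t) ^ k * Real.exp (-(s * t)) with hFdef
  have hF : ∀ k, ∀ s ∈ Set.Icc 0 a, HasDerivAt (F k) (F (k + 1) s) s := fun k s _ => by
    have h1 : HasDerivAt (fun s : ℝ => -(s * t)) (-t) s := by
      simpa using! ((hasDerivAt_id s).mul_const t).neg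
    convert! (h1.exp.const_mul ((-t) ^ k)) using 1
    simp only [hFdef]; ring
  have hM : ∀ s ∈ Set.Icc 0 a, |F (2 * (m + 1)) s| ≤ t ^ (2 * (m + 1)) := fun s hs => by
    simp only [hFdef]
    rw [abs_mul, abs_pow, abs_neg, abs_of_nonneg ht, Real.abs_exp]
    exact mul_le_of_le_one_right (by positivity)
      (Real.exp_le_one_iff.2 (by nlinarith [mul_nonneg hs.1 ht]))
  have hρ := intervalIntegrable_rpow_sub_one (a := a) hα
  have hpos : ∀ s ∈ Set.Ioo 0 a, 0 < s ^ (α - 1) := fun s hs => Real.rpow_pos_of_pos hs.1 _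
  have key := IsGaussRule.error_le h ha hρ hpos hF hM (monic_X.mul hq)
    (by rw [natDegree_mul X_ne_zero hq.ne_zero, natDegree_X, hqn, add_comm])
  have hint : ∫ s in (0 : ℝ)..a, s ^ (α - 1) * (X * q * (X * q)).eval s ≤
      (2 * (a / 4) ^ m) ^ 2 * (a ^ (α + 2) / (α + 2)) := by
    calc _ ≤ ∫ s in (0 : ℝ)..a, (2 * (a / 4) ^ m) ^ 2 * s ^ (α + 1) := by
          refine intervalIntegral.integral_mono_on_of_le_Ioo ha.le
            (intervalIntegrable_mul_eval hρ _)
            ((intervalIntegral.intervalIntegrable_rpow' (by linarith)).const_mul _) fun s hs => ?_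
          have h1 : s ^ (α + 1) = s ^ (α - 1) * s ^ 2 := by
            rw [← Real.rpow_natCast, ← Real.rpow_add hs.1]; norm_num; ring_nf
          have h2 := hqb s (Set.Ioo_subset_Icc_self hs)
          rw [sub_zero] at h2
          have h3 : (X * q * (X * q)).eval s = s ^ 2 * |q.eval s| ^ 2 := by
            rw [sq_abs]; simp; ring
          have h4 := hpos s hs
          rw [h1, h3]
          calc _ ≤ s ^ (α - 1) * (s ^ 2 * (2 * (a / 4) ^ m) ^ 2) := by gcongr
            _ = _ := by ring
      _ = _ := by
        rw [intervalIntegral.integral_const_mul, integral_rpow (Or.inl (by linarith)),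
          show α + 1 + 1 = α + 2 by ring, Real.zero_rpow (by linarith), sub_zero]
  have hL : (∫ s in (0 : ℝ)..a, s ^ (α - 1) * F 0 s) =
      ∫ s in (0 : ℝ)..a, Real.exp (-(s * t)) * s ^ (α - 1) := by
    simp [hFdef, mul_comm]
  have hR : ∑ k, ω k * F 0 (x k) = ∑ k, ω k * Real.exp (-(x k * t)) := by simp [hFdef]
  rw [hL, hR] at key
  refine key.trans ?_
  calc _ ≤ t ^ (2 * (m + 1)) / (2 * (m + 1)).factorial *
        ((2 * (a / 4) ^ m) ^ 2 * (a ^ (α + 2) / (α + 2))) := by gcongr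
    _ = _ := by
      rw [show a ^ (α + 2) = a ^ α * a ^ 2 by
        rw [← Real.rpow_natCast, ← Real.rpow_add ha]; norm_num]
      rw [mul_div_assoc a t 4, mul_pow a (t / 4), div_pow t 4, mul_pow 2, ← pow_mul, div_pow a 4,
        show 2 * (m + 1) = m * 2 + 2 by ring]
      field_simp
      ring

/-! ### Assembling the hybrid rule -/

section Assembly

variable {α : ℝ} {m n : ℤ} {n₁ n₂ : ℕ}

theorem IsGaussJacobi.weight_pos {a : ℝ} {N : ℕ} {x ω : Fin N → ℝ} (h : IsGaussJacobi α a x ω)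
    (hα : 0 < α) (ha : 0 < a) (k : Fin N) : 0 < ω k :=
  IsGaussRule.weight_pos h ha (intervalIntegrable_rpow_sub_one hα)
    (fun _ hs => Real.rpow_pos_of_pos hs.1 _) k

theorem exists_isGaussJacobi {a : ℝ} (hα : 0 < α) (ha : 0 < a) (N : ℕ) :
    ∃ x ω : Fin N → ℝ, IsGaussJacobi α a x ω :=
  exists_isGaussRule ha (intervalIntegrable_rpow_sub_one hα)
    (fun _ hs => Real.rpow_pos_of_pos hs.1 _) N

theorem IsGaussLegendre.weight_pos {a b : ℝ} {N : ℕ} {x ω : Fin N → ℝ}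
    (h : IsGaussLegendre a b x ω) (hab : a < b) (k : Fin N) : 0 < ω k :=
  IsGaussRule.weight_pos h hab intervalIntegrable_const (fun _ _ => one_pos) k

theorem exists_isGaussLegendre {a b : ℝ} (hab : a < b) (N : ℕ) :
    ∃ x ω : Fin N → ℝ, IsGaussLegendre a b x ω :=
  exists_isGaussRule hab intervalIntegrable_const (fun _ _ => one_pos) N

theorem two_zpow_lt_succ (j : ℤ) : (2 : ℝ) ^ j < 2 ^ (j + 1) :=
  zpow_lt_zpow_right₀ one_lt_two (lt_add_one j)

theorem exists_isHybridGauss (hα : 0 < α) (m n : ℤ) (n₁ n₂ : ℕ) :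
    ∃ s w : Fin (n₁ + (m + n).toNat * n₂) → ℝ, IsHybridGauss α m n n₁ n₂ s w := by
  obtain ⟨x₀, ω₀, h₀⟩ := exists_isGaussJacobi hα (zpow_pos two_pos (-m)) n₁
  choose x ω h using fun j : ℤ => exists_isGaussLegendre (two_zpow_lt_succ j) n₂
  let e : (Fin n₁ ⊕ (Finset.Ico (-m) n) × Fin n₂) ≃ Fin (n₁ + (m + n).toNat * n₂) :=
    Fintype.equivFinOfCardEq (by simp [add_comm])
  refine ⟨fun i => Sum.elim x₀ (fun p => x p.1 p.2) (e.symm i),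
    fun i => Sum.elim (fun k => ω₀ k / Real.Gamma α)
      (fun p => ω p.1 p.2 * (x p.1 p.2) ^ (α - 1) / Real.Gamma α) (e.symm i),
    x₀, ω₀, x, ω, h₀, fun j _ => h j, e, fun k => ?_, fun j k => ?_⟩ <;> simp

theorem IsHybridGauss.pos {N : ℕ} {s w : Fin N → ℝ} (h : IsHybridGauss α m n n₁ n₂ s w)
    (hα : 0 < α) : (∀ i, 0 < s i) ∧ ∀ i, 0 < w i := by
  obtain ⟨x₀, ω₀, x, ω, h₀, hx, e, he₀, he⟩ := h
  have hΓ := Real.Gamma_pos_of_pos hα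
  have key : ∀ i, 0 < s i ∧ 0 < w i := fun i => by
    obtain ⟨y, rfl⟩ := e.surjective i
    rcases y with k | ⟨j, k⟩
    · rw [(he₀ k).1, (he₀ k).2]
      exact ⟨(h₀.2.1 k).1, div_pos (h₀.weight_pos hα (zpow_pos two_pos _) k) hΓ⟩
    · rw [(he j k).1, (he j k).2]
      have hxp : 0 < x j k := (zpow_pos two_pos _).trans ((hx j j.2).2.1 k).1
      exact ⟨hxp, div_pos (mul_pos ((hx j j.2).weight_pos (two_zpow_lt_succ _) k)
        (Real.rpow_pos_of_pos hxp _)) hΓ⟩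
  exact ⟨fun i => (key i).1, fun i => (key i).2⟩

theorem integral_exp_mul_rpow {t : ℝ} (hα : 0 < α) (ht : 0 < t) :
    ∫ s in Set.Ioi (0 : ℝ), Real.exp (-(s * t)) * s ^ (α - 1) = Real.Gamma α / t ^ α := by
  have h := Real.integral_rpow_mul_exp_neg_mul_Ioi hα ht
  rw [Real.div_rpow zero_le_one ht.le, Real.one_rpow, one_div_mul_eq_div] at h
  rw [← h]
  simp only [mul_comm]

theorem integrableOn_exp_mul_rpow {t : ℝ} (hα : 0 < α) (ht : 0 < t) :
    MeasureTheory.IntegrableOn (fun s => Real.exp (-(s * t)) * s ^ (α - 1)) (Set.Ioi (0 : ℝ)) := by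
  -- The Bochner integral of a non-integrable function is `0`, so a nonzero value proves
  -- integrability.
  refine MeasureTheory.Integrable.of_integral_ne_zero ?_
  rw [integral_exp_mul_rpow hα ht]
  have := Real.Gamma_pos_of_pos hα
  positivity

theorem sum_integral_dyadic {f : ℝ → ℝ} (hf : MeasureTheory.IntegrableOn f (Set.Ioi (0 : ℝ)))
    (hmn : -m ≤ n) :
    ∑ j ∈ Finset.Ico (-m) n, ∫ s in (2 : ℝ) ^ j..2 ^ (j + 1), f s =
      ∫ s in (2 : ℝ) ^ (-m)..2 ^ n, f s := by
  have hint : ∀ i j : ℤ,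
      IntervalIntegrable f MeasureTheory.volume ((2 : ℝ) ^ i) ((2 : ℝ) ^ j) := fun i j =>
    (hf.mono_set fun s hs => lt_of_lt_of_le
      (lt_min (zpow_pos two_pos i) (zpow_pos two_pos j)) hs.1).intervalIntegrable
  induction n, hmn using Int.leInduction with
  | base => simp
  | succ k hk ih =>
    have : Finset.Ico (-m) (k + 1) = insert k (Finset.Ico (-m) k) := by
      ext j; simp only [Finset.mem_Ico, Finset.mem_insert]; omega
    rw [this, Finset.sum_insert (by simp), ih, add_comm,
      intervalIntegral.integral_add_adjacent_intervals (hint _ _) (hint _ _)]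

/-- Error of the hybrid Gauss sum of exponentials: truncation, Gauss–Jacobi and Gauss–Legendre
parts. -/
theorem IsHybridGauss.error_le {K t : ℝ} {N : ℕ} {s w : Fin N → ℝ}
    (h : IsHybridGauss α m n n₁ n₂ s w) (hα : 0 < α) (hmn : -m ≤ n) (hn₁ : 2 ≤ n₁) (hn₂ : 1 ≤ n₂)
    (hK : ∀ k, |(descPochhammer ℝ k).eval (α - 1)| ≤ K * k.factorial) (hαn : α - 1 ≤ 2 * n₂)
    (ht : 0 < t) :
    |1 / t ^ α - ∑ i, w i * Real.exp (-(s i * t))| ≤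
      1 / Real.Gamma α * ((∫ s in Set.Ioi ((2 : ℝ) ^ n), Real.exp (-(s * t)) * s ^ (α - 1)) +
        64 * ((2 : ℝ) ^ (-m)) ^ α * ((2 : ℝ) ^ (-m) * t / 4) ^ (2 * n₁) /
          ((α + 2) * (2 * n₁).factorial) +
        ∑ j ∈ Finset.Ico (-m) n, 4 * K * ((2 : ℝ) ^ j) ^ α / 16 ^ n₂) := by
  obtain ⟨x₀, ω₀, x, ω, h₀, hx, e, he₀, he⟩ := h
  have hΓ := Real.Gamma_pos_of_pos hα
  set f : ℝ → ℝ := fun s => Real.exp (-(s * t)) * s ^ (α - 1) with hf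
  have hfi := integrableOn_exp_mul_rpow hα ht
  have hfi' : ∀ j : ℤ, MeasureTheory.IntegrableOn f (Set.Ioi ((2 : ℝ) ^ j)) := fun j =>
    hfi.mono_set (Set.Ioi_subset_Ioi (zpow_pos two_pos j).le)
  set I₀ := ∫ s in (0 : ℝ)..2 ^ (-m), f s with hI₀
  set I := fun j : ℤ => ∫ s in (2 : ℝ) ^ j..2 ^ (j + 1), f s with hI
  set Q₀ := ∑ k, ω₀ k * Real.exp (-(x₀ k * t)) with hQ₀
  set Q := fun j : ℤ => ∑ k, ω j k * x j k ^ (α - 1) * Real.exp (-(x j k * t)) with hQ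
  have hsum : ∑ i, w i * Real.exp (-(s i * t)) =
      1 / Real.Gamma α * (Q₀ + ∑ j ∈ Finset.Ico (-m) n, Q j) := by
    rw [← e.sum_comp, Fintype.sum_sum_type, Fintype.sum_prod_type, mul_add, hQ₀, Finset.mul_sum,
      ← Finset.sum_coe_sort (Finset.Ico (-m) n), Finset.mul_sum]
    congr 1
    · refine Finset.sum_congr rfl fun k _ => ?_
      rw [(he₀ k).1, (he₀ k).2]; ring
    · refine Finset.sum_congr rfl fun j _ => ?_
      rw [hQ, Finset.mul_sum]
      refine Finset.sum_congr rfl fun k _ => ?_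
      rw [(he j k).1, (he j k).2]; ring
  have hint : 1 / t ^ α = 1 / Real.Gamma α * (I₀ + ∑ j ∈ Finset.Ico (-m) n, I j +
      ∫ s in Set.Ioi ((2 : ℝ) ^ n), f s) := by
    have h1 := intervalIntegral.integral_interval_add_Ioi hfi (hfi' (-m))
    have h2 := intervalIntegral.integral_interval_add_Ioi (hfi' (-m)) (hfi' n)
    rw [integral_exp_mul_rpow hα ht, ← h2, ← sum_integral_dyadic hfi hmn] at h1
    rw [add_assoc, hI₀, hI, h1]
    field_simp
  have hsplit : 1 / t ^ α - ∑ i, w i * Real.exp (-(s i * t)) = 1 / Real.Gamma α *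
      ((∫ s in Set.Ioi ((2 : ℝ) ^ n), f s) + (I₀ - Q₀) +
        ∑ j ∈ Finset.Ico (-m) n, (I j - Q j)) := by
    rw [hsum, hint, Finset.sum_sub_distrib]; ring
  have hnn : 0 ≤ ∫ s in Set.Ioi ((2 : ℝ) ^ n), f s := by
    refine MeasureTheory.setIntegral_nonneg measurableSet_Ioi fun s hs => ?_
    have : 0 < s := (zpow_pos two_pos n).trans hs
    positivity
  rw [hsplit, abs_mul, abs_of_pos (by positivity : 0 < 1 / Real.Gamma α)]
  refine mul_le_mul_of_nonneg_left ?_ (by positivity)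
  refine (abs_add_le _ _).trans (add_le_add ((abs_add_le _ _).trans (add_le_add ?_ ?_)) ?_)
  · exact (abs_of_nonneg hnn).le
  · exact h₀.error_le hα (zpow_pos two_pos _) hn₁ ht.le
  · refine (Finset.abs_sum_le_sum_abs _ _).trans (Finset.sum_le_sum fun j hj => ?_)
    have h2 : (2 : ℝ) ^ (j + 1) = 2 * 2 ^ j := by rw [zpow_add_one₀ two_ne_zero, mul_comm]
    have := hx j hj
    rw [h2] at this
    simp only [hI, hQ, h2]
    exact this.error_le (zpow_pos two_pos j) hn₂ ht.le hK hαn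

end Assembly

/-! ### The explicit bound for `0 < α < 1` -/

theorem two_rpow_mul_intCast (β : ℝ) (n : ℤ) : (2 : ℝ) ^ (β * (n : ℝ)) = ((2 : ℝ) ^ n) ^ β := by
  rw [mul_comm, Real.rpow_mul two_pos.le, Real.rpow_intCast]

theorem integral_Ioi_exp_mul_rpow_le {α δ t b : ℝ} (hα1 : α < 1) (hδ : 0 < δ) (hδt : δ ≤ t)
    (hb : 0 < b) (hα : 0 < α) :
    ∫ s in Set.Ioi b, Real.exp (-(s * t)) * s ^ (α - 1) ≤
      Real.exp (-(δ * b)) / (δ * b ^ (1 - α)) := by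
  have hneg : -δ < 0 := neg_lt_zero.2 hδ
  calc _ ≤ ∫ s in Set.Ioi b, Real.exp (-δ * s) * b ^ (α - 1) := by
        refine MeasureTheory.setIntegral_mono_on ?_ ?_ measurableSet_Ioi fun s hs => ?_
        · exact (integrableOn_exp_mul_rpow hα (hδ.trans_le hδt)).mono_set
            (Set.Ioi_subset_Ioi hb.le)
        · exact (integrableOn_exp_mul_Ioi hneg b).mul_const _
        · have hs' : b < s := hs
          have h1 : s ^ (α - 1) ≤ b ^ (α - 1) :=
            Real.rpow_le_rpow_of_nonpos hb hs'.le (by linarith)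
          have h2 : -(s * t) ≤ -δ * s := by nlinarith
          have h3 : 0 < s := hb.trans hs'
          gcongr
    _ = _ := by
        rw [MeasureTheory.integral_mul_const, integral_exp_mul_Ioi hneg,
          show α - 1 = -(1 - α) by ring, Real.rpow_neg hb.le, neg_div_neg_eq, neg_mul]
        field_simp

/-- Converts the Jacobi constant of `IsGaussJacobi.error_le` into the stated one, by Stirling's
lower bound for `(2N)!` and `(1 - 1/(2N)) ^ (4N) ≤ exp (-2)`. -/
theorem jacobi_const_le {α : ℝ} (hα : 0 < α) {N : ℕ} (hN : 2 ≤ N) :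
    64 / ((α + 2) * (2 * N).factorial) * (1 / 4) ^ (2 * N) ≤
      4 * √Real.pi / Real.exp 1 ^ 2 * ((2 * (N : ℝ) - 1) * (N : ℝ) ^ (3 / 2 : ℝ) /
        (2 * (N : ℝ) + α)) * (Real.exp 1 * N / (2 * (2 * (N : ℝ) - 1) ^ 2)) ^ (2 * N) := by
  have hN' : (2 : ℝ) ≤ N := by exact_mod_cast hN
  have hN0 : (0 : ℝ) < N := by linarith
  have hd : (0 : ℝ) < 2 * N - 1 := by linarith
  have hπ := Real.pi_pos
  have he := Real.exp_pos 1
  set y : ℝ := (Real.exp 1 / (8 * N)) ^ (2 * N) with hy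
  have hy0 : 0 < y := by positivity
  have h1 : Real.exp 1 ^ 2 * y ≤
      (Real.exp 1 * N / (2 * (2 * (N : ℝ) - 1) ^ 2)) ^ (2 * N) := by
    have h2 : 2 * (N : ℝ) - 1 ≤ 2 * N * Real.exp (-(1 / (2 * N))) := by
      have := Real.add_one_le_exp (-(1 / (2 * (N : ℝ))))
      calc 2 * (N : ℝ) - 1 = 2 * N * (-(1 / (2 * N)) + 1) := by field_simp; ring
        _ ≤ _ := by gcongr
    have h3 : (2 * (N : ℝ) - 1) ^ (4 * N) ≤ (2 * N) ^ (4 * N) * Real.exp (-2) := by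
      calc _ ≤ (2 * N * Real.exp (-(1 / (2 * (N : ℝ))))) ^ (4 * N) := by gcongr
        _ = _ := by
          rw [mul_pow, ← Real.exp_nat_mul]
          congr 2
          push_cast; field_simp; norm_num
    calc Real.exp 1 ^ 2 * y = (Real.exp 1 * N / 2) ^ (2 * N) /
          ((2 * N) ^ (4 * N) * Real.exp (-2)) := by
          rw [Real.exp_neg, show Real.exp 2 = Real.exp 1 ^ 2 by rw [← Real.exp_nat_mul]; norm_num,
            show 4 * N = 2 * (2 * N) by ring, pow_mul (2 * (N : ℝ)) 2, div_mul_eq_div_div,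
            ← div_pow, div_inv_eq_mul, mul_comm, hy]
          congr 2
          field_simp; ring
      _ ≤ (Real.exp 1 * N / 2) ^ (2 * N) / (2 * (N : ℝ) - 1) ^ (4 * N) := by gcongr
      _ = _ := by
          rw [show 4 * N = 2 * (2 * N) by ring, pow_mul (2 * (N : ℝ) - 1) 2, ← div_pow, div_div]
  have h4 : 2 * √Real.pi * √N * (1 / 4) ^ (2 * N) ≤ y * (2 * N).factorial := by
    have h5 := Stirling.le_factorial_stirling (2 * N)
    have h6 : √(2 * Real.pi * ((2 * N : ℕ) : ℝ)) = 2 * √Real.pi * √N := by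
      rw [show 2 * Real.pi * ((2 * N : ℕ) : ℝ) = 2 ^ 2 * (Real.pi * N) by push_cast; ring,
        Real.sqrt_mul (by positivity), Real.sqrt_mul hπ.le, Real.sqrt_sq two_pos.le]
      ring
    rw [h6] at h5
    calc 2 * √Real.pi * √N * (1 / 4) ^ (2 * N)
        = y * (2 * √Real.pi * √N * (((2 * N : ℕ) : ℝ) / Real.exp 1) ^ (2 * N)) := by
          rw [hy, mul_left_comm, ← mul_pow]
          congr 2
          push_cast; field_simp; norm_num
      _ ≤ _ := by gcongr
  have h7 : (N : ℝ) ^ (3 / 2 : ℝ) = N * √N := by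
    rw [Real.sqrt_eq_rpow, ← Real.rpow_one_add' hN0.le (by norm_num)]; norm_num
  have hsN : √(N : ℝ) * √N = N := Real.mul_self_sqrt hN0.le
  have hsπ : √Real.pi * √Real.pi = Real.pi := Real.mul_self_sqrt hπ.le
  have h8 : 64 * (2 * (N : ℝ) + α) ≤ 8 * Real.pi * (2 * N - 1) * N ^ 2 * (α + 2) := by
    have h9 : 2 * (N : ℝ) + α ≤ (α + 2) * N := by nlinarith
    have h10 : 64 ≤ 8 * Real.pi * ((2 * N - 1) * N) := by
      have : 6 ≤ (2 * (N : ℝ) - 1) * N := by nlinarith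
      nlinarith [Real.pi_gt_three]
    calc 64 * (2 * (N : ℝ) + α) ≤ 8 * Real.pi * ((2 * N - 1) * N) * ((α + 2) * N) := by gcongr
      _ = _ := by ring
  have hfac : (0 : ℝ) < (2 * N).factorial := by positivity
  have hsN0 : 0 < √(N : ℝ) := Real.sqrt_pos.2 hN0
  have hsπ0 : 0 < √Real.pi := Real.sqrt_pos.2 hπ
  calc 64 / ((α + 2) * (2 * N).factorial) * (1 / 4) ^ (2 * N)
      = 64 / ((α + 2) * (2 * N).factorial * (2 * √Real.pi * √N)) *
          (2 * √Real.pi * √N * (1 / 4) ^ (2 * N)) := by field_simp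
    _ ≤ 64 / ((α + 2) * (2 * N).factorial * (2 * √Real.pi * √N)) * (y * (2 * N).factorial) := by
        gcongr
    _ = 64 / ((α + 2) * (2 * √Real.pi * √N)) * y := by field_simp
    _ ≤ 4 * √Real.pi * ((2 * (N : ℝ) - 1) * (N * √N) / (2 * (N : ℝ) + α)) * y := by
        refine mul_le_mul_of_nonneg_right ?_ hy0.le
        rw [← mul_div_assoc, div_le_div_iff₀ (by positivity) (by positivity)]
        calc 64 * (2 * (N : ℝ) + α) ≤ 8 * Real.pi * (2 * N - 1) * N ^ 2 * (α + 2) := h8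
          _ = 8 * (√Real.pi * √Real.pi) * (2 * N - 1) * (N * (√N * √N)) * (α + 2) := by
            rw [hsN, hsπ]; ring
          _ = _ := by ring
    _ = 4 * √Real.pi / Real.exp 1 ^ 2 * ((2 * (N : ℝ) - 1) * (N : ℝ) ^ (3 / 2 : ℝ) /
          (2 * (N : ℝ) + α)) * (Real.exp 1 ^ 2 * y) := by
        rw [h7]; field_simp
    _ ≤ _ := by
        gcongr

theorem IsHybridGauss.error_le_hybridGaussBound {α δ T t : ℝ} {m n : ℤ} {n₁ n₂ N : ℕ}
    {s w : Fin N → ℝ} (h : IsHybridGauss α m n n₁ n₂ s w) (hα : 0 < α) (hα1 : α < 1) (hδ : 0 < δ)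
    (hmn : -m ≤ n) (hn₁ : 2 ≤ n₁) (hn₂ : 2 ≤ n₂) (ht : t ∈ Set.Icc δ T) :
    |1 / t ^ α - ∑ i, w i * Real.exp (-(s i * t))| ≤ hybridGaussBound α δ T m n n₁ n₂ := by
  have ht0 : 0 < t := hδ.trans_le ht.1
  have hT : 0 < T := ht0.trans_le ht.2
  have hΓ := Real.Gamma_pos_of_pos hα
  refine (h.error_le hα hmn hn₁ (by omega) (abs_eval_descPochhammer_le_factorial hα hα1)
    (by have : (0 : ℝ) ≤ n₂ := n₂.cast_nonneg
        linarith) ht0).trans ?_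
  rw [hybridGaussBound, add_assoc, mul_add]
  have ha : (0 : ℝ) < 2 ^ (-m) := zpow_pos two_pos _
  refine add_le_add ?_ (mul_le_mul_of_nonneg_left (add_le_add ?_ ?_) (by positivity))
  · rw [two_rpow_mul_intCast, mul_assoc, mul_comm (Real.Gamma α), ← div_div,
      one_div_mul_eq_div]
    gcongr
    exact integral_Ioi_exp_mul_rpow_le hα1 hδ ht.1 (zpow_pos two_pos n) hα
  · have h1 : (2 : ℝ) ^ (-(α * (m : ℝ))) = ((2 : ℝ) ^ (-m)) ^ α := by
      rw [← two_rpow_mul_intCast]; push_cast; ring_nf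
    rw [h1]
    set a : ℝ := (2 : ℝ) ^ (-m)
    have hN' : (2 : ℝ) ≤ n₁ := by exact_mod_cast hn₁
    calc _ = a ^ α * (a * t) ^ (2 * n₁) *
          (64 / ((α + 2) * (2 * n₁).factorial) * (1 / 4) ^ (2 * n₁)) := by
          rw [div_eq_mul_one_div (a * t) 4, mul_pow (a * t)]; ring
      _ ≤ a ^ α * (a * T) ^ (2 * n₁) *
          (4 * √Real.pi / Real.exp 1 ^ 2 * ((2 * (n₁ : ℝ) - 1) * (n₁ : ℝ) ^ (3 / 2 : ℝ) /
            (2 * (n₁ : ℝ) + α)) *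
              (Real.exp 1 * n₁ / (2 * (2 * (n₁ : ℝ) - 1) ^ 2)) ^ (2 * n₁)) := by
          have := ht.2
          refine mul_le_mul ?_ (jacobi_const_le hα hn₁) (by positivity) (by positivity)
          gcongr
      _ = _ := by
          rw [show a * Real.exp 1 * n₁ * T / (2 * (2 * (n₁ : ℝ) - 1) ^ 2) =
            a * T * (Real.exp 1 * n₁ / (2 * (2 * (n₁ : ℝ) - 1) ^ 2)) by ring, mul_pow (a * T)]
          ring
  · rw [Finset.mul_sum, Finset.sum_mul]
    refine Finset.sum_le_sum fun j _ => ?_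
    rw [two_rpow_mul_intCast, div_pow, show (4 : ℝ) ^ (2 * n₂) = 16 ^ n₂ by
      rw [pow_mul]; norm_num, ← mul_div_assoc]
    -- The Legendre estimate is stronger than the stated term: `4 ≤ 2√2 π`, and the power of `exp
    -- (1/e)` is pure slack.
    have h1 : 1 ≤ Real.exp (1 / Real.exp 1) ^ (2 * n₂) :=
      one_le_pow₀ (Real.one_le_exp (by positivity))
    have h2 : (4 : ℝ) * 1 ≤ 2 * √2 * Real.pi := by
      have : (1 : ℝ) ≤ √2 := Real.one_le_sqrt.2 one_le_two
      nlinarith [Real.pi_gt_three]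
    have h3 : (0 : ℝ) < ((2 : ℝ) ^ j) ^ α := Real.rpow_pos_of_pos (zpow_pos two_pos j) _
    rw [div_le_div_iff_of_pos_right (by positivity)]
    calc _ = 4 * 1 * ((2 : ℝ) ^ j) ^ α * 1 := by ring
      _ ≤ 2 * √2 * Real.pi * ((2 : ℝ) ^ j) ^ α * Real.exp (1 / Real.exp 1) ^ (2 * n₂) := by
        gcongr

/-! ### The bound on the number of nodes -/

/-- Half of the exponent supplies the decay at `b`; the other half keeps a full Gamma integral,
whose `Γ α` later cancels the prefactor. Unlike the monotonicity argument for `α < 1`, this works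
for every `α > 0`. -/
theorem integral_Ioi_exp_mul_rpow_le_Gamma {α t b : ℝ} (hα : 0 < α) (ht : 0 < t) (hb : 0 < b) :
    ∫ s in Set.Ioi b, Real.exp (-(s * t)) * s ^ (α - 1) ≤
      Real.exp (-(b * (t / 2))) * (Real.Gamma α / (t / 2) ^ α) := by
  have ht2 : 0 < t / 2 := half_pos ht
  have hsub : Set.Ioi b ⊆ Set.Ioi (0 : ℝ) := Set.Ioi_subset_Ioi hb.le
  have hi := (integrableOn_exp_mul_rpow hα ht2).const_mul (Real.exp (-(b * (t / 2))))
  rw [← integral_exp_mul_rpow hα ht2, ← MeasureTheory.integral_const_mul]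
  calc _ ≤ ∫ s in Set.Ioi b,
        Real.exp (-(b * (t / 2))) * (Real.exp (-(s * (t / 2))) * s ^ (α - 1)) := by
        refine MeasureTheory.setIntegral_mono_on ((integrableOn_exp_mul_rpow hα ht).mono_set hsub)
          (MeasureTheory.IntegrableOn.mono_set hi hsub) measurableSet_Ioi fun s hs => ?_
        have hs' : b < s := hs
        have hs0 : 0 < s := hb.trans hs'
        rw [← mul_assoc, ← Real.exp_add]
        have : -(s * t) ≤ -(b * (t / 2)) + -(s * (t / 2)) := by nlinarith
        gcongr
    _ ≤ _ := by
        refine MeasureTheory.setIntegral_mono_set hi ?_ hsub.eventuallyLE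
        filter_upwards [MeasureTheory.ae_restrict_mem measurableSet_Ioi] with s hs
        have hs0 : 0 < s := hs
        simp only [Pi.zero_apply]
        positivity

/-- Written as `α / Γ (α + 1)`, the reciprocal Gamma function is continuous up to `α = 0`, so
compactness of `[0, A]` applies. -/
theorem exists_inv_Gamma_le (A : ℝ) :
    ∃ γ : ℝ, 0 ≤ γ ∧ ∀ α : ℝ, 0 < α → α ≤ A → 1 / Real.Gamma α ≤ Real.exp γ := by
  have hcont : ContinuousOn (fun α : ℝ => α / Real.Gamma (α + 1)) (Set.Icc 0 A) := by
    intro α hα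
    have h1 : 0 < α + 1 := by linarith [hα.1]
    refine ContinuousAt.continuousWithinAt (continuousAt_id.div ?_ (Real.Gamma_pos_of_pos h1).ne')
    refine ContinuousAt.comp (f := fun α : ℝ => α + 1) (g := Real.Gamma) ?_ (by fun_prop)
    refine (Real.differentiableAt_Gamma fun k hk => ?_).continuousAt
    have : (0 : ℝ) ≤ k := k.cast_nonneg
    linarith
  obtain ⟨C, hC⟩ := isCompact_Icc.exists_bound_of_continuousOn hcont
  refine ⟨max 0 C, le_max_left _ _, fun α h0 hA => ?_⟩
  have h := (le_abs_self _).trans (hC α ⟨h0.le, hA⟩)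
  rw [Real.Gamma_add_one h0.ne', div_mul_cancel_left₀ h0.ne', inv_eq_one_div] at h
  calc _ ≤ C := h
    _ ≤ max 0 C + 1 := by linarith [le_max_right 0 C]
    _ ≤ _ := Real.add_one_le_exp _

/-- This is how the final constant comes to depend on `T₀`. -/
theorem rpow_neg_le_exp {A T₀ α T : ℝ} (hT₀ : 0 < T₀) (hα : 0 < α) (hαA : α ≤ A)
    (hT : T₀ ≤ T) : (1 / T) ^ α ≤ Real.exp (A * max 0 (Real.log (1 / T₀))) := by
  have hT0 : 0 < T := hT₀.trans_le hT
  have h1 : 1 / T ≤ Real.exp (max 0 (Real.log (1 / T₀))) := by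
    calc 1 / T ≤ 1 / T₀ := one_div_le_one_div_of_le hT₀ hT
      _ = Real.exp (Real.log (1 / T₀)) := (Real.exp_log (by positivity)).symm
      _ ≤ _ := Real.exp_le_exp.2 (le_max_right _ _)
  calc (1 / T) ^ α ≤ Real.exp (max 0 (Real.log (1 / T₀))) ^ α := by gcongr
    _ = Real.exp (α * max 0 (Real.log (1 / T₀))) := by rw [← Real.exp_mul, mul_comm]
    _ ≤ _ := by gcongr

theorem one_sixteenth_pow_le (q : ℕ) : (1 / 16 : ℝ) ^ q ≤ Real.exp (-q) := by
  have h1 : (1 / 16 : ℝ) ≤ Real.exp (-1) := by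
    rw [Real.exp_neg, ← one_div]
    exact one_div_le_one_div_of_le (Real.exp_pos 1) (by linarith [Real.exp_one_lt_d9])
  calc _ ≤ Real.exp (-1) ^ q := by gcongr
    _ = Real.exp (-q) := by rw [← Real.exp_nat_mul]; ring_nf

/-- Here, as in the next two lemmas, all factors are put in the form `exp` of something linear in
the parameters, so that the final comparison with `ε₀` is linear arithmetic of exponents. -/
theorem truncation_error_le {A β α δ t b : ℝ} (hα : 0 < α) (hαA : α ≤ A) (hδ : 0 < δ)
    (hδt : δ ≤ t) (hb : 0 < b) (hδα : (1 / δ) ^ α ≤ Real.exp β) :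
    1 / Real.Gamma α * (∫ s in Set.Ioi b, Real.exp (-(s * t)) * s ^ (α - 1)) ≤
      Real.exp (-(b * δ / 2) + (A + β)) := by
  have ht0 : 0 < t := hδ.trans_le hδt
  have hΓ := Real.Gamma_pos_of_pos hα
  calc _ ≤ 1 / Real.Gamma α * (Real.exp (-(b * (t / 2))) * (Real.Gamma α / (t / 2) ^ α)) := by
        gcongr
        exact integral_Ioi_exp_mul_rpow_le_Gamma hα ht0 hb
    _ = Real.exp (-(b * (t / 2))) * (2 ^ α * (1 / t) ^ α) := by
        rw [← Real.mul_rpow two_pos.le (by positivity), mul_one_div, ← inv_div t 2,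
          Real.inv_rpow (by positivity)]
        field_simp
    _ ≤ Real.exp (-(b * δ / 2)) * (Real.exp A * Real.exp β) := by
        have e1 : b * δ / 2 ≤ b * (t / 2) := by
          have : b * δ ≤ b * t := by gcongr
          linarith
        have e2 : (1 / t) ^ α ≤ Real.exp β := by
          refine le_trans ?_ hδα
          have := one_div_le_one_div_of_le hδ hδt
          gcongr
        have e3 : (2 : ℝ) ^ α ≤ Real.exp A := by
          have : (2 : ℝ) ≤ Real.exp 1 := by linarith [Real.add_one_le_exp 1]
          calc (2 : ℝ) ^ α ≤ Real.exp 1 ^ α := by gcongr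
            _ = Real.exp α := by rw [← Real.exp_mul, one_mul]
            _ ≤ _ := by gcongr
        gcongr
    _ = _ := by rw [← Real.exp_add, ← Real.exp_add]

theorem jacobi_error_le {α γ κ a t : ℝ} (q : ℕ) (hα : 0 < α)
    (hγ : 1 / Real.Gamma α ≤ Real.exp γ) (ha : 0 < a) (ht : 0 < t) (hat : a * t ≤ 1)
    (haκ : a ^ α ≤ Real.exp κ) :
    1 / Real.Gamma α * (64 * a ^ α * (a * t / 4) ^ (2 * q) / ((α + 2) * (2 * q).factorial)) ≤
      Real.exp (4 + (γ + (κ + -q))) := by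
  have hΓ := Real.Gamma_pos_of_pos hα
  calc _ ≤ 1 / Real.Gamma α * (64 * a ^ α * (a * t / 4) ^ (2 * q) / (2 * 1)) := by
        have : (1 : ℝ) ≤ (2 * q).factorial := by exact_mod_cast (2 * q).factorial_pos
        gcongr
        linarith
    _ ≤ Real.exp γ * (64 * Real.exp κ * Real.exp (-q) / (2 * 1)) := by
        have e2 : (a * t / 4) ^ (2 * q) ≤ Real.exp (-q) := by
          refine le_trans ?_ (one_sixteenth_pow_le q)
          rw [show (1 / 16 : ℝ) = (1 / 4) ^ 2 by norm_num, ← pow_mul]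
          gcongr
        gcongr
    _ ≤ Real.exp 4 * (Real.exp γ * (Real.exp κ * Real.exp (-q))) := by
        have : (32 : ℝ) ≤ Real.exp 4 := by
          rw [show (4 : ℝ) = 2 * 2 by norm_num, Real.exp_mul, Real.rpow_two]
          have : (6 : ℝ) ≤ Real.exp 2 := by
            rw [show (2 : ℝ) = 1 * 2 by norm_num, Real.exp_mul, Real.rpow_two]
            nlinarith [Real.exp_one_gt_d9]
          nlinarith
        calc _ = 32 * (Real.exp γ * (Real.exp κ * Real.exp (-q))) := by ring
          _ ≤ _ := by gcongr
    _ = _ := by simp only [Real.exp_add]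

/-- Each term is bounded by its value at `2 ^ n`. Paying the number of intervals avoids summing a
geometric series of ratio `2 ^ α`, whose constant degenerates as `α → 0`. -/
theorem legendre_error_le {α γ β ν K : ℝ} {k n : ℤ} (q : ℕ) (hα : 0 < α) (hK : 0 < K)
    (hγ : 1 / Real.Gamma α ≤ Real.exp γ) (hkn : k ≤ n) (hν : ((n - k : ℤ) : ℝ) ≤ ν)
    (hβ : ((2 : ℝ) ^ n) ^ α ≤ Real.exp β) :
    1 / Real.Gamma α * ∑ j ∈ Finset.Ico k n, 4 * K * ((2 : ℝ) ^ j) ^ α / 16 ^ q ≤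
      Real.exp (γ + (ν + (4 * K + (β + -q)))) := by
  have hΓ := Real.Gamma_pos_of_pos hα
  have hcard : ((Finset.Ico k n).card : ℝ) = ((n - k : ℤ) : ℝ) := by
    rw [Int.card_Ico]
    exact_mod_cast congrArg (Int.cast (R := ℝ)) (Int.toNat_of_nonneg (sub_nonneg.2 hkn))
  have hsum : ∑ j ∈ Finset.Ico k n, 4 * K * ((2 : ℝ) ^ j) ^ α / 16 ^ q ≤
      ((Finset.Ico k n).card : ℝ) * (4 * K * (((2 : ℝ) ^ n) ^ α * (1 / 16) ^ q)) := by
    rw [← nsmul_eq_mul]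
    refine Finset.sum_le_card_nsmul _ _ _ fun j hj => ?_
    have hjn : (2 : ℝ) ^ j ≤ 2 ^ n := zpow_le_zpow_right₀ one_le_two (Finset.mem_Ico.1 hj).2.le
    have hj0 : (0 : ℝ) < 2 ^ j := zpow_pos two_pos j
    rw [one_div_pow, mul_one_div, ← mul_div_assoc]
    gcongr
  have h4K : 4 * K ≤ Real.exp (4 * K) := by linarith [Real.add_one_le_exp (4 * K)]
  have hν' : ((Finset.Ico k n).card : ℝ) ≤ Real.exp ν := by
    rw [hcard]
    linarith [Real.add_one_le_exp ν]
  have hn0 : (0 : ℝ) < 2 ^ n := zpow_pos two_pos n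
  calc _ ≤ 1 / Real.Gamma α *
        (((Finset.Ico k n).card : ℝ) * (4 * K * (((2 : ℝ) ^ n) ^ α * (1 / 16) ^ q))) := by gcongr
    _ ≤ Real.exp γ * (Real.exp ν * (Real.exp (4 * K) * (Real.exp β * Real.exp (-q)))) := by
        gcongr
        exact one_sixteenth_pow_le q
    _ = _ := by simp only [Real.exp_add]

theorem exists_hybridGauss_error_le {A T₀ : ℝ} (hA : 0 < A) (hT₀ : 0 < T₀) :
    ∃ C : ℝ, ∀ α δ T ε₀ : ℝ,
      0 < α → α ≤ A → 0 < δ → δ < T → T₀ ≤ T → 0 < ε₀ →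
      ∃ (N : ℕ) (s w : Fin N → ℝ),
        (N : ℝ) ≤ C * (1 + max 0 (Real.log (1 / ε₀)) + Real.log (T / δ)) ^ 2 ∧
        (∀ i, 0 < s i) ∧ (∀ i, 0 < w i) ∧
        (∀ t ∈ Set.Icc δ T, |1 / t ^ α - ∑ i, w i * Real.exp (-(s i * t))| ≤ ε₀) ∧
        ∃ (m n : ℤ) (n₁ n₂ : ℕ), -m ≤ n ∧ 2 ≤ n₁ ∧ 2 ≤ n₂ ∧ IsHybridGauss α m n n₁ n₂ s w := by
  obtain ⟨γ, hγ0, hγ⟩ := exists_inv_Gamma_le A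
  set κ : ℝ := A * max 0 (Real.log (1 / T₀)) with hκ
  have hκ0 : 0 ≤ κ := mul_nonneg hA.le (le_max_left _ _)
  set K : ℝ := max 1 A ^ ⌈A⌉₊ with hKdef
  have hM1 : (1 : ℝ) ≤ max 1 A := le_max_left _ _
  have hK0 : 0 < K := by positivity
  -- Chosen so that half of `B * X` covers `A + κ + A * Lr + Le + 2`, the exponent needed for the
  -- tail.
  set B : ℝ := 2 * (2 * A + κ + 2) with hB
  -- Chosen so that `C * X` dominates every exponent in the Jacobi and Legendre errors; see `hXC`.
  set C : ℝ := γ + κ + 4 * K + 8 * B + 2 * A * B + A + 8 with hC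
  have hB1 : 1 ≤ B := by rw [hB]; linarith
  have hAB : 0 < A * B := by positivity
  have hC1 : 1 ≤ C := by rw [hC]; linarith
  -- The product of the bounds `q ≤ (C + 1) * X` and `1 + (n - k) ≤ (8 * B + 3) * X`.
  refine ⟨(C + 1) * (8 * B + 3), fun α δ T ε₀ hα hαA hδ hδT hT hε => ?_⟩
  have hT0 : 0 < T := hδ.trans hδT
  set Le := max 0 (Real.log (1 / ε₀)) with hLe
  set Lr := Real.log (T / δ) with hLr
  set X := 1 + Le + Lr with hX
  have hLe0 : 0 ≤ Le := le_max_left _ _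
  have hLr0 : 0 ≤ Lr := Real.log_nonneg (by rw [le_div_iff₀ hδ]; linarith)
  have hX1 : 1 ≤ X := by linarith
  have hX0 : 0 < X := by linarith
  have hεe : Real.exp (-Le) ≤ ε₀ := by
    rw [← Real.le_log_iff_exp_le hε]
    have : Real.log (1 / ε₀) ≤ Le := le_max_right _ _
    rw [one_div, Real.log_inv] at this
    linarith
  -- Each of the three error parts may use a third of `ε₀`, and `3 ≤ exp 2`.
  have h3 : Real.exp (-Le - 2) ≤ ε₀ / 3 := by
    have h2 : 3 ≤ Real.exp 2 := by linarith [Real.add_one_le_exp 2]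
    rw [Real.exp_sub]
    gcongr
  have hTα : (1 / T) ^ α ≤ Real.exp κ := rpow_neg_le_exp hT₀ hα hαA hT
  have hexpLr : Real.exp Lr = T / δ := Real.exp_log (by positivity)
  have hδα : (1 / δ) ^ α ≤ Real.exp (κ + A * Lr) := by
    have h1 : (1 / δ : ℝ) = 1 / T * Real.exp Lr := by rw [hexpLr]; field_simp
    rw [h1, Real.mul_rpow (by positivity) (by positivity), Real.exp_add, ← Real.exp_mul, mul_comm Lr]
    gcongr
  -- Dyadic rounding: `2 ^ n` with `n = n' + 1` is at least `B * X / δ` and at most twice that,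
  -- while `2 ^ k` is the largest power of two not above `1 / T`, so that `2 ^ k * t ≤ 1` on the
  -- whole interval.
  obtain ⟨n', hn'l, hn'u⟩ := exists_mem_Ioc_zpow (x := B * X / δ) (y := (2 : ℝ)) (by positivity)
    one_lt_two
  obtain ⟨k, hkl, hku⟩ := exists_mem_Ico_zpow (x := 1 / T) (y := (2 : ℝ)) (by positivity)
    one_lt_two
  set n : ℤ := n' + 1 with hn
  have hb_le : (2 : ℝ) ^ n ≤ 2 * B * X / δ := by
    rw [hn, zpow_add_one₀ two_ne_zero]
    calc _ ≤ B * X / δ * 2 := by gcongr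
      _ = _ := by ring
  set b : ℝ := (2 : ℝ) ^ n with hb
  set a : ℝ := (2 : ℝ) ^ k with ha
  have ha0 : 0 < a := zpow_pos two_pos k
  have hb0 : 0 < b := zpow_pos two_pos n
  have hkn : k ≤ n := by
    rw [← zpow_le_zpow_iff_right₀ (one_lt_two (α := ℝ))]
    calc (2 : ℝ) ^ k ≤ 1 / T := hkl
      _ ≤ 1 / δ := one_div_le_one_div_of_le hδ hδT.le
      _ ≤ B * X / δ := by gcongr; exact one_le_mul_of_one_le_of_one_le hB1 hX1
      _ ≤ _ := hn'u
  have hnk : ((n - k : ℤ) : ℝ) ≤ (8 * B + 2) * X := by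
    -- The ratio `b / a` is at most `4 * B * X * (T / δ)`, so its logarithm is linear in `X`;
    -- dividing by `log 2 ≥ 1/2` doubles the coefficients.
    have h1 : (2 : ℝ) ^ (n - k) ≤ Real.exp (4 * B * X + Lr) := by
      rw [zpow_sub₀ two_ne_zero, ← hb, ← ha, div_le_iff₀ ha0, Real.exp_add, hexpLr]
      have h2 : 1 / T < 2 * a := by rw [zpow_add_one₀ two_ne_zero] at hku; linarith
      have h4 : 4 * B * X ≤ Real.exp (4 * B * X) := by
        linarith [Real.add_one_le_exp (4 * B * X)]
      calc b ≤ 2 * B * X / δ := hb_le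
        _ = 4 * B * X * (T / δ) * (1 / T / 2) := by field_simp; ring
        _ ≤ Real.exp (4 * B * X) * (T / δ) * a := by
          have h5 : 1 / T / 2 ≤ a := by linarith
          gcongr
    have h6 : Real.log ((2 : ℝ) ^ (n - k)) ≤ 4 * B * X + Lr :=
      (Real.log_le_iff_le_exp (zpow_pos two_pos _)).2 h1
    rw [Real.log_zpow] at h6
    have h7 : (0 : ℝ) ≤ ((n - k : ℤ) : ℝ) := by exact_mod_cast sub_nonneg.2 hkn
    have h8 : ((n - k : ℤ) : ℝ) * (1 / 2) ≤ ((n - k : ℤ) : ℝ) * Real.log 2 :=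
      mul_le_mul_of_nonneg_left (by linarith [Real.log_two_gt_d9]) h7
    linarith
  have hbα : b ^ α ≤ Real.exp (2 * A * B * X + (κ + A * Lr)) := by
    calc b ^ α ≤ (2 * B * X * (1 / δ)) ^ α := by
          rw [mul_one_div]; gcongr
      _ = (2 * B * X) ^ α * (1 / δ) ^ α := Real.mul_rpow (by positivity) (by positivity)
      _ ≤ Real.exp (2 * B * X) ^ α * Real.exp (κ + A * Lr) := by
          have : 2 * B * X ≤ Real.exp (2 * B * X) := by
            linarith [Real.add_one_le_exp (2 * B * X)]
          gcongr
      _ = Real.exp (α * (2 * B * X)) * Real.exp (κ + A * Lr) := by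
          rw [← Real.exp_mul, mul_comm α]
      _ ≤ Real.exp (A * (2 * B * X)) * Real.exp (κ + A * Lr) := by gcongr
      _ = _ := by rw [← Real.exp_add]; ring_nf
  set q : ℕ := ⌈C * X⌉₊ with hq
  have hq_ge : C * X ≤ q := Nat.le_ceil _
  have hq_le : (q : ℝ) ≤ (C + 1) * X := by
    have := (Nat.ceil_lt_add_one (by positivity : 0 ≤ C * X)).le
    rw [← hq] at this
    linarith
  have hCX : C ≤ C * X := le_mul_of_one_le_right (by linarith) hX1
  have hq2 : 2 ≤ q := by
    have : (2 : ℝ) ≤ q := by rw [hC] at hCX hq_ge; linarith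
    exact_mod_cast this
  have hαq : α - 1 ≤ 2 * q := by rw [hC] at hCX hq_ge; linarith
  have hXC : γ + κ + 4 * K + (8 * B + 2) * X + 2 * A * B * X + A * Lr + Le + 6 ≤ C * X := by
    have e1 : γ ≤ γ * X := le_mul_of_one_le_right hγ0 hX1
    have e2 : κ ≤ κ * X := le_mul_of_one_le_right hκ0 hX1
    have e3 : 4 * K ≤ 4 * K * X := le_mul_of_one_le_right (by positivity) hX1
    have e4 : A * Lr ≤ A * X := mul_le_mul_of_nonneg_left (by linarith) hA.le
    have e5 : Le + 6 ≤ 6 * X := by linarith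
    have e6 : C * X = γ * X + κ * X + 4 * K * X + 8 * B * X + 2 * A * B * X + A * X + 8 * X := by
      rw [hC]; ring
    linarith
  have hABX : 0 ≤ A * B * X := by positivity
  have hALr : 0 ≤ A * Lr := by positivity
  have hBX : 0 ≤ B * X := by positivity
  obtain ⟨s, w, hsw⟩ := exists_isHybridGauss hα (-k) n q q
  refine ⟨_, s, w, ?_, (hsw.pos hα).1, (hsw.pos hα).2, fun t ht => ?_, -k, n, q, q,
    by simpa using hkn, hq2, hq2, hsw⟩
  · have h1 : (((-k + n).toNat : ℕ) : ℝ) = ((n - k : ℤ) : ℝ) := by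
      have : ((-k + n).toNat : ℤ) = n - k := by omega
      exact_mod_cast congrArg (Int.cast (R := ℝ)) this
    push_cast at h1 hnk ⊢
    rw [h1]
    calc (q : ℝ) + (n - k) * q = q * (1 + (n - k)) := by ring
      _ ≤ (C + 1) * X * (X + (8 * B + 2) * X) := by
        have : (0 : ℝ) ≤ n - k := by exact_mod_cast sub_nonneg.2 hkn
        gcongr
      _ = _ := by ring
  have ht0 : 0 < t := hδ.trans_le ht.1
  have hΓ := Real.Gamma_pos_of_pos hα
  have hKb : ∀ j, |(descPochhammer ℝ j).eval (α - 1)| ≤ K * j.factorial := fun j =>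
    (abs_eval_descPochhammer_le hα hαA j).trans (by
      rw [hKdef]
      gcongr
      exact min_le_right _ _)
  refine (hsw.error_le hα (by simpa using hkn) hq2 (by omega) hKb hαq ht0).trans ?_
  rw [neg_neg, ← ha, ← hb]
  have hγα := hγ α hα hαA
  have p1 : 1 / Real.Gamma α * (∫ s in Set.Ioi b, Real.exp (-(s * t)) * s ^ (α - 1)) ≤
      ε₀ / 3 := by
    refine (truncation_error_le hα hαA hδ ht.1 hb0 hδα).trans (le_trans ?_ h3)
    have e0 : B * X ≤ b * δ := by rwa [← div_le_iff₀ hδ]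
    have e1 : B * X = 4 * (A * X) + 2 * (κ * X) + 4 * X := by rw [hB]; ring
    have e2 : κ ≤ κ * X := le_mul_of_one_le_right hκ0 hX1
    have e3 : A ≤ A * X := le_mul_of_one_le_right hA.le hX1
    have e4 : A * Lr ≤ A * X := mul_le_mul_of_nonneg_left (by linarith) hA.le
    exact Real.exp_le_exp.2 (by linarith)
  have p2 : 1 / Real.Gamma α *
      (64 * a ^ α * (a * t / 4) ^ (2 * q) / ((α + 2) * (2 * q).factorial)) ≤ ε₀ / 3 := by
    have hat : a * t ≤ 1 := (mul_le_mul hkl ht.2 ht0.le (by positivity)).trans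
      (one_div_mul_cancel hT0.ne').le
    have haκ : a ^ α ≤ Real.exp κ := (Real.rpow_le_rpow ha0.le hkl hα.le).trans hTα
    exact (jacobi_error_le q hα hγα ha0 ht0 hat haκ).trans
      ((Real.exp_le_exp.2 (by linarith)).trans h3)
  have p3 : 1 / Real.Gamma α * ∑ j ∈ Finset.Ico k n, 4 * K * ((2 : ℝ) ^ j) ^ α / 16 ^ q ≤
      ε₀ / 3 :=
    (legendre_error_le q hα hK0 hγα hkn hnk hbα).trans
      ((Real.exp_le_exp.2 (by linarith)).trans h3)
  rw [mul_add, mul_add]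
  linarith

theorem mainTheorem3 :
    (∀ A T₀ : ℝ, 0 < A → 0 < T₀ → ∃ C : ℝ, ∀ α δ T ε₀ : ℝ,
      0 < α → α ≤ A → 0 < δ → δ < T → T₀ ≤ T → 0 < ε₀ →
      ∃ (N : ℕ) (s w : Fin N → ℝ),
        (N : ℝ) ≤ C * (1 + max 0 (Real.log (1 / ε₀)) + Real.log (T / δ)) ^ 2 ∧
        (∀ i, 0 < s i) ∧ (∀ i, 0 < w i) ∧
        (∀ t ∈ Set.Icc δ T, |1 / t ^ α - ∑ i, w i * Real.exp (-(s i * t))| ≤ ε₀) ∧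
        ∃ (m n : ℤ) (n₁ n₂ : ℕ), -m ≤ n ∧ 2 ≤ n₁ ∧ 2 ≤ n₂ ∧ IsHybridGauss α m n n₁ n₂ s w) ∧
    (∀ (α δ T : ℝ) (m n : ℤ) (n₁ n₂ : ℕ),
      0 < α → α < 1 → 0 < δ → δ < T → -m ≤ n → 2 ≤ n₁ → 2 ≤ n₂ →
      (∃ s w : Fin (n₁ + (m + n).toNat * n₂) → ℝ, IsHybridGauss α m n n₁ n₂ s w) ∧
      ∀ (N : ℕ) (s w : Fin N → ℝ), IsHybridGauss α m n n₁ n₂ s w →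
        (∀ i, 0 < s i) ∧ (∀ i, 0 < w i) ∧
        ∀ t ∈ Set.Icc δ T, |1 / t ^ α - ∑ i, w i * Real.exp (-(s i * t))| ≤
          hybridGaussBound α δ T m n n₁ n₂) := by
  refine ⟨fun A T₀ hA hT₀ => exists_hybridGauss_error_le hA hT₀,
    fun α δ T m n n₁ n₂ hα hα1 hδ _ hmn hn₁ hn₂ => ⟨exists_isHybridGauss hα m n n₁ n₂,
      fun N s w h => ⟨(h.pos hα).1, (h.pos hα).2, fun t ht =>
        h.error_le_hybridGaussBound hα hα1 hδ hmn hn₁ hn₂ ht⟩⟩⟩
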